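/- Let $d,n\ge 0$ be integers, let $\mathcal G$ be a compact (Hausdorff, second countable) topological group with normalised Haar measure $\lambda$, and let $\phi$ be a measurable orthogonal representation of $\mathcal G$ on $\mathbb R^d$. A function $f:\mathbb R^d\to\mathbb R$ is called $\mathcal G$-invariant if $f(\phi(g)x)=f(x)$ for all $g\in\mathcal G$ and $x\in\mathbb R^d$. For $w\in\mathbb R^d$ write $h_w(x)=w^\top x$. Let $X\sim\mathcal N(0,\sigma_X^2 I_d)$ with $\sigma_X^2>0$, and let $Y=h_\theta(X)+\xi$, where $\theta\in\mathbb R^d$ is such that $h_\theta$ is $\mathcal G$-invariant, and $\xi$ is a real random variable, independent of $X$, with mean $0$ and variance $\sigma_\xi^2<\infty$. The risk of a predictor $f$ is $R[f]=\mathbb E[(f(X)-Y)^2]$; if $f$ is itself random, the risk is conditional on the randomness of $f$. Let $(X_i,Y_i)$, $i=1,\dots,n$, be i.i.d. copies of $(X,Y)$, independent of $(X,Y)$. Let $w$ be the least squares estimate of $\theta$ from these examples, that is, the minimiser of $\sum_{i=1}^n (Y_i-u^\top X_i)^2$ over $u\in\mathbb R^d$ that has the smallest Euclidean norm. Let $h_{\bar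 w}(x)=\int_{\mathcal G}h_w(\phi(g)x)\,\mathrm d\lambda(g)$ be the averaged version of $h_w$. Let $A$ be the orthogonal complement, in $L_2$ of the law of $X$, of the subspace of $\mathcal G$-invariant linear predictors inside the space $\{h_u:u\in\mathbb R^d\}$ of all linear predictors. **Theorem.** 1. If $n>d+1$, the gap $R[h_w]-R[h_{\bar w}]$ is integrable and $$\mathbb E\bigl[R[h_w]-R[h_{\bar w}]\bigr]=\sigma_\xi^2\,\frac{\dim A}{n-d-1}.$$ 2. If $n\in[d-1,d+1]$, $\sigma_\xi^2>0$, and it is not the case that $h_w$ is almost surely $\mathcal G$-invariant, then $R[h_w]-R[h_{\bar w}]\ge 0$ almost surely and $\mathbb E\bigl[R[h_w]-R[h_{\bar w}]\bigr]=\infty$. 3. If $n<d-1$, the gap $R[h_w]-R[h_{\bar w}]$ is integrable and $$\mathbb E\bigl[R[h_w]-R[h_{\bar w}]\bigr]=\dim A\left(\sigma_X^2\|\theta\|_2^2\,\frac{n(d-n)}{d(d-1)(d+2)}+\sigma_\xi^2\,\frac{n}{d(d-n-1)}\right).$$ The expectations are over the training sample. All of this holds with $\ge$ in place of $=$ when $h_{\bar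 w}$ is replaced by any (possibly random) predictor $h'$, square integrable for the law of $X$ and with measurable conditional risk $R[h']$, such that $R[h']\le R[h_{\bar w}]$ almost surely; in the situation of 2 the expected gap is again $\infty$. -/

import Mathlib

open MeasureTheory ProbabilityTheory

noncomputable section

namespace InvariantRegression

/-- The law `N(0, σ² I)` on `ℝ^d`. -/
def gaussianInput (d : ℕ) (σ : ℝ) : Measure (EuclideanSpace ℝ (Fin d)) :=
  multivariateGaussian 0 ((σ ^ 2) • (1 : Matrix (Fin d) (Fin d) ℝ))

instance isGaussian_gaussianInput (d : ℕ) (σ : ℝ) : IsGaussian (gaussianInput d σ) := by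
  unfold gaussianInput
  infer_instance

/-- The linear predictor `h_w(x) = wᵀ x`. -/
def linPredictor {d : ℕ} (w : EuclideanSpace ℝ (Fin d)) : EuclideanSpace ℝ (Fin d) → ℝ :=
  fun x => inner ℝ w x

/-- `f` is `G`-invariant: `f (φ(g) x) = f x` for all `g` and `x`. -/
def IsInvariantPredictor {d : ℕ} {G : Type*} [Group G]
    (φ : G →* (EuclideanSpace ℝ (Fin d) ≃ₗᵢ[ℝ] EuclideanSpace ℝ (Fin d)))
    (f : EuclideanSpace ℝ (Fin d) → ℝ) : Prop :=
  ∀ (g : G) (x : EuclideanSpace ℝ (Fin d)), f (φ g x) = f x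

/-- The averaged version of `f`: the function `x ↦ ∫ f (φ(g) x) dν(g)`. -/
def orbitAverage {d : ℕ} {G : Type*} [Group G] [MeasurableSpace G] (ν : Measure G)
    (φ : G →* (EuclideanSpace ℝ (Fin d) ≃ₗᵢ[ℝ] EuclideanSpace ℝ (Fin d)))
    (f : EuclideanSpace ℝ (Fin d) → ℝ) : EuclideanSpace ℝ (Fin d) → ℝ :=
  fun x => ∫ g, f (φ g x) ∂ν

/-- The subspace `S` of `G`-invariant linear predictors, in the parametrisation `w ↦ h_w`. -/
def symmetricSubspace {d : ℕ} {G : Type*} [Group G]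
    (φ : G →* (EuclideanSpace ℝ (Fin d) ≃ₗᵢ[ℝ] EuclideanSpace ℝ (Fin d))) :
    Submodule ℝ (EuclideanSpace ℝ (Fin d)) where
  carrier := {w | IsInvariantPredictor φ (linPredictor w)}
  zero_mem' := fun g x => by simp [linPredictor]
  add_mem' := fun {a b} ha hb g x => by
    have h1 := ha g x
    have h2 := hb g x
    simp only [linPredictor] at h1 h2 ⊢
    rw [inner_add_left, inner_add_left, h1, h2]
  smul_mem' := fun c a ha g x => by
    have h1 := ha g x
    simp only [linPredictor] at h1 ⊢
    rw [real_inner_smul_left, real_inner_smul_left, h1]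

theorem integrable_linPredictor_mul {d : ℕ} (μ : Measure (EuclideanSpace ℝ (Fin d)))
    [IsGaussian μ] (a b : EuclideanSpace ℝ (Fin d)) :
    Integrable (fun x => linPredictor a x * linPredictor b x) μ := by
  have h : ∀ c : EuclideanSpace ℝ (Fin d), MemLp (linPredictor c) 2 μ := fun c =>
    IsGaussian.memLp_dual μ (innerSL ℝ c) 2 (by simp)
  exact (h a).integrable_mul (h b)

/-- The orthogonal complement `A` of `S` among the linear predictors, for the inner product
`⟨f, h⟩ = ∫ f h dμ` of `L²(μ)`, in the parametrisation `w ↦ h_w`. -/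
def antisymmetricSubspace {d : ℕ} {G : Type*} [Group G]
    (μ : Measure (EuclideanSpace ℝ (Fin d))) [IsGaussian μ]
    (φ : G →* (EuclideanSpace ℝ (Fin d) ≃ₗᵢ[ℝ] EuclideanSpace ℝ (Fin d))) :
    Submodule ℝ (EuclideanSpace ℝ (Fin d)) where
  carrier := {w | ∀ s ∈ symmetricSubspace φ, ∫ x, linPredictor s x * linPredictor w x ∂μ = 0}
  zero_mem' := fun s _ => by simp [linPredictor]
  add_mem' := fun {a b} ha hb s hs => by
    have h : (fun x => linPredictor s x * linPredictor (a + b) x)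
        = fun x => linPredictor s x * linPredictor a x + linPredictor s x * linPredictor b x := by
      funext x
      simp only [linPredictor, inner_add_left]
      ring
    rw [h, integral_add (integrable_linPredictor_mul μ s a) (integrable_linPredictor_mul μ s b),
      ha s hs, hb s hs, add_zero]
  smul_mem' := fun c a ha s hs => by
    have h : (fun x => linPredictor s x * linPredictor (c • a) x)
        = fun x => c * (linPredictor s x * linPredictor a x) := by
      funext x
      simp only [linPredictor, real_inner_smul_left]
      ring
    rw [h, integral_const_mul, ha s hs, mul_zero]

/-- The sum of squared errors of `h_u` on the examples `(x i, y i)`. -/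
def sumSquaredErrors {d n : ℕ} (x : Fin n → EuclideanSpace ℝ (Fin d)) (y : Fin n → ℝ)
    (u : EuclideanSpace ℝ (Fin d)) : ℝ :=
  ∑ i, (y i - linPredictor u (x i)) ^ 2

/-- `u` minimises the sum of squared errors. -/
def IsLeastSquares {d n : ℕ} (x : Fin n → EuclideanSpace ℝ (Fin d)) (y : Fin n → ℝ)
    (u : EuclideanSpace ℝ (Fin d)) : Prop :=
  ∀ v, sumSquaredErrors x y u ≤ sumSquaredErrors x y v

/-- There is exactly one least squares solution of minimal Euclidean norm. -/
theorem existsUnique_minNorm {d n : ℕ} (x : Fin n → EuclideanSpace ℝ (Fin d))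
    (y : Fin n → ℝ) :
    ∃! w, IsLeastSquares x y w ∧ ∀ u, IsLeastSquares x y u → ‖w‖ ≤ ‖u‖ := by
  let L : EuclideanSpace ℝ (Fin d) →ₗ[ℝ] EuclideanSpace ℝ (Fin n) :=
    { toFun := fun u => WithLp.toLp 2 (fun i => inner ℝ u (x i))
      map_add' := fun a b => by ext i; simp [inner_add_left]
      map_smul' := fun c a => by ext i; simp [real_inner_smul_left] }
  let Y : EuclideanSpace ℝ (Fin n) := WithLp.toLp 2 y
  have hsse : ∀ u, sumSquaredErrors x y u = ‖Y - L u‖ ^ 2 := fun u => by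
    rw [EuclideanSpace.norm_sq_eq]
    simp [sumSquaredErrors, linPredictor, L, Y]
  obtain ⟨u₀, hu₀⟩ : ∃ u, L u = (LinearMap.range L).starProjection Y :=
    LinearMap.mem_range.1 (Submodule.starProjection_apply_mem _ Y)
  have hpyth : ∀ u, ‖Y - L u‖ ^ 2 = ‖Y - L u₀‖ ^ 2 + ‖L u₀ - L u‖ ^ 2 := fun u => by
    have h0 : inner ℝ (Y - L u₀) (L u₀ - L u) = 0 := by
      rw [hu₀]
      exact Submodule.inner_left_of_mem_orthogonal
        (Submodule.sub_mem _ (Submodule.starProjection_apply_mem _ Y) (LinearMap.mem_range_self L u))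
        (Submodule.sub_starProjection_mem_orthogonal Y)
    have h1 : Y - L u = (Y - L u₀) + (L u₀ - L u) := by abel
    rw [h1, norm_add_sq_real, h0]
    ring
  have hmin : ∀ u, IsLeastSquares x y u ↔ L u = L u₀ := fun u => by
    constructor
    · intro h
      have h1 := h u₀
      rw [hsse, hsse, hpyth u] at h1
      have h2 : ‖L u₀ - L u‖ = 0 := by nlinarith [norm_nonneg (L u₀ - L u)]
      exact (sub_eq_zero.1 (norm_eq_zero.1 h2)).symm
    · intro h v
      rw [hsse, hsse, hpyth v, h]
      nlinarith [sq_nonneg ‖L u₀ - L v‖]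
  let w := (LinearMap.ker L)ᗮ.starProjection u₀
  have hw : L w = L u₀ := by
    have h1 : u₀ - w ∈ (LinearMap.ker L)ᗮᗮ := Submodule.sub_starProjection_mem_orthogonal u₀
    rw [Submodule.orthogonal_orthogonal, LinearMap.mem_ker, map_sub, sub_eq_zero] at h1
    exact h1.symm
  have hwu : ∀ u, L u = L u₀ → ‖u‖ ^ 2 = ‖w‖ ^ 2 + ‖u - w‖ ^ 2 := fun u hu => by
    have hk : u - w ∈ LinearMap.ker L := by
      rw [LinearMap.mem_ker, map_sub, hu, hw, sub_self]
    have h0 : inner ℝ w (u - w) = 0 :=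
      Submodule.inner_left_of_mem_orthogonal hk (Submodule.starProjection_apply_mem _ u₀)
    have h1 : u = w + (u - w) := by abel
    conv_lhs => rw [h1]
    rw [norm_add_sq_real, h0]
    ring
  refine ⟨w, ⟨(hmin w).2 hw, fun u hu => ?_⟩, fun v hv => ?_⟩
  · have h1 := hwu u ((hmin u).1 hu)
    exact (sq_le_sq₀ (norm_nonneg w) (norm_nonneg u)).1 (by nlinarith [sq_nonneg ‖u - w‖])
  · have h1 := hwu v ((hmin v).1 hv.1)
    have h2 := hv.2 w ((hmin w).2 hw)
    have h3 : ‖v - w‖ = 0 := by nlinarith [norm_nonneg (v - w), norm_nonneg v, norm_nonneg w]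
    exact sub_eq_zero.1 (norm_eq_zero.1 h3)

/-- The least squares estimate: the minimiser of the sum of squared errors that has minimal
Euclidean norm. -/
def leastSquares {d n : ℕ} (x : Fin n → EuclideanSpace ℝ (Fin d)) (y : Fin n → ℝ) :
    EuclideanSpace ℝ (Fin d) :=
  (existsUnique_minNorm x y).choose

/-- The risk `R[f] = E[(f(X) - Y)²]` of a fixed predictor `f`. For a random predictor `F ω`,
`risk P X Y (F ω)` is the risk conditional on the randomness of `F`. -/
def risk {Ω : Type*} [MeasurableSpace Ω] {d : ℕ} (P : Measure Ω)
    (X : Ω → EuclideanSpace ℝ (Fin d)) (Y : Ω → ℝ) (f : EuclideanSpace ℝ (Fin d) → ℝ) : ℝ :=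
  ∫ ω, (f (X ω) - Y ω) ^ 2 ∂P

/-- The generalisation gap `R[f] - R[f']`. -/
def genGap {Ω : Type*} [MeasurableSpace Ω] {d : ℕ} (P : Measure Ω)
    (X : Ω → EuclideanSpace ℝ (Fin d)) (Y : Ω → ℝ) (f f' : EuclideanSpace ℝ (Fin d) → ℝ) : ℝ :=
  risk P X Y f - risk P X Y f'

end InvariantRegression

end

/-!
The gap to the averaged predictor depends only on the estimate `w`. Averaging over the group is the
orthogonal projection onto the invariant linear predictors (`orbitAverage_linPredictor`), the risk
of `h_u` is `σX² ‖u - θ‖²` plus a constant, and `θ` is invariant; so the gap equals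
`σX² ‖P_A w‖²`, where `P_A` is the projection to the orthogonal complement `A` of the invariant
vectors (`genGap_linPredictor_orbitAverage`).

Let `x` be the `n × d` matrix of the inputs, `P` the orthogonal projection to its row space, and
`p₁, …, pₙ` the columns of its pseudoinverse. Then `w = P θ + ∑ εᵢ pᵢ` for the noise `ε`, which is
independent of `x`. Integrating over the noise gives
`E ‖P_A w‖² = E ‖P_A P θ‖² + σξ² E ∑ ‖P_A pᵢ‖²`
(`lintegral_norm_sq_starProjection_noisyEstimate`). Both terms are evaluated by means of the
invariance of the law of `x` under rotations.

*Variance.* All directions contribute equally to the second term, so that it is `dim A / d` times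
`E ∑ ‖pᵢ‖²` (`lintegral_sum_norm_sq_starProjection_pinvColumn`). If `n ≤ d`, the `pᵢ` form almost
surely the dual basis of the rows, so `1 / ‖pᵢ‖` is the distance of the `i`-th row from the span of
the other rows. Given these, that distance is the norm of a Gaussian vector in a space of dimension
`d - n + 1`, and the expectation of `1 / ‖Z‖²` for a Gaussian vector `Z` in dimension `k` is
`1 / (σX² (k - 2))` for `k > 2` and infinite otherwise (`lintegral_inv_norm_sq_starProjection`). If
`n ≥ d`, the same applies to the transposed matrix, which is again Gaussian
(`measurePreserving_columns`) and whose pseudoinverse has the same Frobenius norm. In both cases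
`k = |d - n| + 1`; so, for `n, d > 0`, `E ∑ ‖pᵢ‖²` is infinite exactly if `|d - n| ≤ 1`.

*Bias.* If `n ≥ d`, then `P = 1` almost surely and `P_A θ = 0`. If `n ≤ d`, the first term is
`dim A ‖θ‖²` times the mean square of an off-diagonal entry of `P`; rotation invariance, `P² = P`
and `tr P = n` determine it (`projMoment_of_orthonormal`).
-/

namespace InvariantRegression

/-! ### Averaging over the group -/

theorem mem_symmetricSubspace_iff {d : ℕ} {G : Type*} [Group G]
    {φ : G →* (EuclideanSpace ℝ (Fin d) ≃ₗᵢ[ℝ] EuclideanSpace ℝ (Fin d))}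
    {w : EuclideanSpace ℝ (Fin d)} :
    w ∈ symmetricSubspace φ ↔ IsInvariantPredictor φ (linPredictor w) := Iff.rfl

theorem apply_eq_self_of_mem_symmetricSubspace {d : ℕ} {G : Type*} [Group G]
    {φ : G →* (EuclideanSpace ℝ (Fin d) ≃ₗᵢ[ℝ] EuclideanSpace ℝ (Fin d))}
    {s : EuclideanSpace ℝ (Fin d)} (hs : s ∈ symmetricSubspace φ) (g : G) : φ g s = s := by
  refine ext_inner_right ℝ fun x => ?_
  have h := hs g ((φ g).symm x)
  simp only [linPredictor, LinearIsometryEquiv.apply_symm_apply] at h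
  have h' := LinearIsometryEquiv.inner_map_map (φ g) s ((φ g).symm x)
  rw [LinearIsometryEquiv.apply_symm_apply] at h'
  rw [h', h]

/-- A compact group is unimodular: its normalised Haar measure is right invariant, because
right translates of it are again normalised Haar measures. -/
theorem isMulRightInvariant_of_compact {G : Type*} [Group G] [TopologicalSpace G]
    [IsTopologicalGroup G] [CompactSpace G] [MeasurableSpace G] [BorelSpace G]
    [SecondCountableTopology G]
    (ν : Measure G) [ν.IsHaarMeasure] [IsProbabilityMeasure ν] : ν.IsMulRightInvariant where
  map_mul_right_eq_self g := by
    have : IsProbabilityMeasure (ν.map (· * g)) :=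
      Measure.isProbabilityMeasure_map (measurable_mul_const g).aemeasurable
    exact Measure.isHaarMeasure_eq_of_isProbabilityMeasure _ _

/-- The average of `h_w` is `h_v` for an invariant `v`, by right invariance of the measure, and
`w - v` is orthogonal to every invariant `s`, since `⟨w, φ(g) s⟩ = ⟨w, s⟩`. -/
theorem orbitAverage_linPredictor {d : ℕ} {G : Type*} [Group G] [TopologicalSpace G]
    [IsTopologicalGroup G] [CompactSpace G] [SecondCountableTopology G] [MeasurableSpace G]
    [BorelSpace G] (ν : Measure G) [ν.IsHaarMeasure] [IsProbabilityMeasure ν]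
    (φ : G →* (EuclideanSpace ℝ (Fin d) ≃ₗᵢ[ℝ] EuclideanSpace ℝ (Fin d)))
    (hφ : Measurable fun p : G × EuclideanSpace ℝ (Fin d) => φ p.1 p.2)
    (w : EuclideanSpace ℝ (Fin d)) :
    orbitAverage ν φ (linPredictor w)
      = linPredictor ((symmetricSubspace φ).starProjection w) := by
  have hright := isMulRightInvariant_of_compact ν
  have hint : ∀ x, Integrable (fun g => inner ℝ w (φ g x)) ν := fun x => by
    have hm : Measurable fun g => φ g x := hφ.comp (measurable_id.prodMk measurable_const)
    refine Integrable.of_bound (measurable_const.inner hm).aestronglyMeasurable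
      (‖w‖ * ‖x‖) (ae_of_all _ fun g => ?_)
    simpa using norm_inner_le_norm (𝕜 := ℝ) w (φ g x)
  let L : EuclideanSpace ℝ (Fin d) →ₗ[ℝ] ℝ :=
    { toFun := orbitAverage ν φ (linPredictor w)
      map_add' := fun x y => by
        simp only [orbitAverage, linPredictor, map_add, inner_add_right]
        exact integral_add (hint x) (hint y)
      map_smul' := fun c x => by
        simp only [orbitAverage, linPredictor, map_smul, inner_smul_right, smul_eq_mul,
          RingHom.id_apply]
        exact integral_const_mul _ _ }
  let v := (InnerProductSpace.toDual ℝ (EuclideanSpace ℝ (Fin d))).symm L.toContinuousLinearMap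
  have hv : ∀ x, inner ℝ v x = ∫ g, inner ℝ w (φ g x) ∂ν := fun x => by
    simp only [v, InnerProductSpace.toDual_symm_apply]
    rfl
  have hvS : v ∈ symmetricSubspace φ := fun k x => by
    simp only [linPredictor, hv]
    have := integral_mul_right_eq_self (μ := ν) (fun g => inner ℝ w (φ g x)) k
    simpa [map_mul] using this
  have hort : ∀ s ∈ symmetricSubspace φ, inner ℝ (w - v) s = 0 := fun s hs => by
    simp [inner_sub_left, hv, apply_eq_self_of_mem_symmetricSubspace hs]
  rw [Submodule.eq_starProjection_of_mem_of_inner_eq_zero hvS hort]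
  funext x
  exact (hv x).symm

/-! ### The risk of linear predictors -/

theorem gaussianInput_eq_map_stdGaussian (d : ℕ) (σ : ℝ) :
    gaussianInput d σ = (stdGaussian (EuclideanSpace ℝ (Fin d))).map (fun x => σ • x) := by
  have hS : ((σ ^ 2) • (1 : Matrix (Fin d) (Fin d) ℝ)).PosSemidef :=
    Matrix.PosSemidef.one.smul (sq_nonneg σ)
  have : IsFiniteMeasure ((stdGaussian (EuclideanSpace ℝ (Fin d))).map (fun x => σ • x)) :=
    inferInstance
  refine Measure.ext_of_charFun ?_
  ext t
  have h1 : (inner ℝ t t : ℝ) = ‖t‖ ^ 2 := real_inner_self_eq_norm_sq t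
  have h2 : t.ofLp ⬝ᵥ t.ofLp = ‖t‖ ^ 2 := by
    rw [← h1, EuclideanSpace.inner_eq_star_dotProduct]; simp
  rw [gaussianInput, charFun_multivariateGaussian hS, charFun_map_smul, charFun_stdGaussian,
    Matrix.smul_mulVec, Matrix.one_mulVec, dotProduct_smul, h2, norm_smul]
  have h3 : ((|σ| : ℝ) : ℂ) ^ 2 = (σ : ℂ) ^ 2 := by
    rw [← Complex.ofReal_pow, sq_abs, Complex.ofReal_pow]
  simp [mul_pow, neg_div, h3]

theorem integral_linPredictor_mul (d : ℕ) (σ : ℝ) (a b : EuclideanSpace ℝ (Fin d)) :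
    ∫ x, linPredictor a x * linPredictor b x ∂(gaussianInput d σ) = σ ^ 2 * inner ℝ a b := by
  have hS : ((σ ^ 2) • (1 : Matrix (Fin d) (Fin d) ℝ)).PosSemidef :=
    Matrix.PosSemidef.one.smul (sq_nonneg σ)
  have h0 : ∀ c : EuclideanSpace ℝ (Fin d),
      ∫ x, inner ℝ c x ∂(gaussianInput d σ) = 0 := fun c => by
    rw [integral_inner IsGaussian.integrable_fun_id c, gaussianInput,
      integral_id_multivariateGaussian, inner_zero_right]
  have h := covarianceBilin_multivariateGaussian (μ := 0) hS a b
  change covarianceBilin (gaussianInput d σ) a b = _ at h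
  rw [covarianceBilin_apply_eq_cov IsGaussian.memLp_two_id, covariance, h0, h0] at h
  simp only [sub_zero] at h
  simp only [linPredictor]
  rw [h, Matrix.smul_mulVec, Matrix.one_mulVec, dotProduct_smul, smul_eq_mul,
    EuclideanSpace.inner_eq_star_dotProduct, dotProduct_comm]
  simp

theorem antisymmetricSubspace_eq_orthogonal {d : ℕ} {G : Type*} [Group G] {σ : ℝ} (hσ : 0 < σ)
    (φ : G →* (EuclideanSpace ℝ (Fin d) ≃ₗᵢ[ℝ] EuclideanSpace ℝ (Fin d))) :
    antisymmetricSubspace (gaussianInput d σ) φ = (symmetricSubspace φ)ᗮ := by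
  ext w
  rw [Submodule.mem_orthogonal]
  refine forall₂_congr fun s _ => ?_
  rw [integral_linPredictor_mul]
  simp [hσ.ne']

/-- The risk of `h_u` is `σX² ‖u - θ‖²` plus the variance of the noise. -/
theorem risk_linPredictor {Ω : Type*} [MeasurableSpace Ω] {P : Measure Ω} [IsProbabilityMeasure P]
    {d : ℕ} {σX σξ : ℝ} {θ : EuclideanSpace ℝ (Fin d)}
    {X : Ω → EuclideanSpace ℝ (Fin d)} {ξ Y : Ω → ℝ}
    (hX : HasLaw X (gaussianInput d σX) P)
    (hξ : MemLp ξ 2 P) (hξ_mean : ∫ ω, ξ ω ∂P = 0) (hξ_var : Var[ξ; P] = σξ ^ 2)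
    (hXξ : IndepFun X ξ P) (hY : ∀ ω, Y ω = linPredictor θ (X ω) + ξ ω)
    (u : EuclideanSpace ℝ (Fin d)) :
    risk P X Y (linPredictor u) = σX ^ 2 * ‖u - θ‖ ^ 2 + σξ ^ 2 := by
  set a := u - θ
  have hm : Measurable (linPredictor a) := (innerSL ℝ a).continuous.measurable
  have hL : MemLp (linPredictor a) 2 (gaussianInput d σX) :=
    IsGaussian.memLp_dual _ (innerSL ℝ a) 2 (by simp)
  have hLX : MemLp (fun ω => linPredictor a (X ω)) 2 P := by
    have := hL
    rw [← hX.map_eq] at this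
    exact this.comp_of_map hX.aemeasurable
  have h1 : ∫ ω, linPredictor a (X ω) ^ 2 ∂P = σX ^ 2 * ‖a‖ ^ 2 := by
    have := hX.integral_comp (f := fun x => linPredictor a x * linPredictor a x)
      (hm.mul hm).aestronglyMeasurable
    rw [integral_linPredictor_mul, real_inner_self_eq_norm_sq] at this
    rw [← this]
    simp [sq]
  have h2 : ∫ ω, ξ ω ^ 2 ∂P = σξ ^ 2 := by
    rw [← hξ_var, variance_of_integral_eq_zero hξ.aemeasurable hξ_mean]
  have h3 : ∫ ω, linPredictor a (X ω) * ξ ω ∂P = 0 := by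
    have hind : IndepFun (fun ω => linPredictor a (X ω)) ξ P := hXξ.comp hm measurable_id
    rw [hind.integral_fun_mul_eq_mul_integral hLX.aestronglyMeasurable hξ.aestronglyMeasurable,
      hξ_mean, mul_zero]
  have h4 : ∀ ω, (linPredictor u (X ω) - Y ω) ^ 2
      = linPredictor a (X ω) ^ 2 - 2 * (linPredictor a (X ω) * ξ ω) + ξ ω ^ 2 := fun ω => by
    rw [hY]
    simp only [linPredictor, a, inner_sub_left]
    ring
  have i1 : Integrable (fun ω => linPredictor a (X ω) ^ 2) P := hLX.integrable_sq
  have i2 : Integrable (fun ω => 2 * (linPredictor a (X ω) * ξ ω)) P :=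
    (hLX.integrable_mul hξ).const_mul 2
  unfold risk
  simp_rw [h4]
  rw [integral_add (f := fun ω => linPredictor a (X ω) ^ 2 - 2 * (linPredictor a (X ω) * ξ ω))
      (i1.sub i2) hξ.integrable_sq, integral_sub i1 i2, integral_const_mul, h1, h2, h3]
  ring

/-- The gap to the averaged predictor is the squared length of the part of `w` that is orthogonal
to the invariant predictors: the invariant part of `w` contributes the same to both risks. -/
theorem genGap_linPredictor_orbitAverage {d : ℕ} {G : Type*} [Group G] [TopologicalSpace G]
    [IsTopologicalGroup G] [CompactSpace G] [SecondCountableTopology G] [MeasurableSpace G]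
    [BorelSpace G] (ν : Measure G) [ν.IsHaarMeasure] [IsProbabilityMeasure ν]
    (φ : G →* (EuclideanSpace ℝ (Fin d) ≃ₗᵢ[ℝ] EuclideanSpace ℝ (Fin d)))
    (hφ : Measurable fun p : G × EuclideanSpace ℝ (Fin d) => φ p.1 p.2)
    {Ω : Type*} [MeasurableSpace Ω] {P : Measure Ω} [IsProbabilityMeasure P]
    {σX σξ : ℝ} {θ : EuclideanSpace ℝ (Fin d)} (hθ : θ ∈ symmetricSubspace φ)
    {X : Ω → EuclideanSpace ℝ (Fin d)} {ξ Y : Ω → ℝ}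
    (hX : HasLaw X (gaussianInput d σX) P)
    (hξ : MemLp ξ 2 P) (hξ_mean : ∫ ω, ξ ω ∂P = 0) (hξ_var : Var[ξ; P] = σξ ^ 2)
    (hXξ : IndepFun X ξ P) (hY : ∀ ω, Y ω = linPredictor θ (X ω) + ξ ω)
    (u : EuclideanSpace ℝ (Fin d)) :
    genGap P X Y (linPredictor u) (orbitAverage ν φ (linPredictor u))
      = σX ^ 2 * ‖(symmetricSubspace φ)ᗮ.starProjection u‖ ^ 2 := by
  rw [genGap, orbitAverage_linPredictor ν φ hφ, risk_linPredictor hX hξ hξ_mean hξ_var hXξ hY,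
    risk_linPredictor hX hξ hξ_mean hξ_var hXξ hY]
  have hort : inner ℝ ((symmetricSubspace φ).starProjection u - θ)
      ((symmetricSubspace φ)ᗮ.starProjection u) = 0 :=
    Submodule.inner_right_of_mem_orthogonal
      (Submodule.sub_mem _ (Submodule.starProjection_apply_mem _ _) hθ)
      (Submodule.starProjection_apply_mem _ _)
  have hdec : u - θ = ((symmetricSubspace φ).starProjection u - θ)
      + (symmetricSubspace φ)ᗮ.starProjection u := by
    rw [Submodule.starProjection_orthogonal_val]
    abel
  rw [hdec, norm_add_sq_real, hort]
  ring

/-! ### The minimal norm least squares solution -/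

section LeastSquares

variable {d n : ℕ}

theorem sumSquaredErrors_add (x : Fin n → EuclideanSpace ℝ (Fin d)) (y : Fin n → ℝ)
    (u z : EuclideanSpace ℝ (Fin d)) :
    sumSquaredErrors x y (u + z) = sumSquaredErrors x y u
      - 2 * inner ℝ z (∑ i, (y i - inner ℝ u (x i)) • x i) + ∑ i, inner ℝ z (x i) ^ 2 := by
  simp only [sumSquaredErrors, linPredictor, inner_add_left, inner_sum, inner_smul_right,
    Finset.mul_sum]
  rw [← Finset.sum_sub_distrib, ← Finset.sum_add_distrib]
  exact Finset.sum_congr rfl fun i _ => by ring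

/-- The minimisers of the sum of squared errors are the solutions of the normal equations. -/
theorem isLeastSquares_iff {x : Fin n → EuclideanSpace ℝ (Fin d)} {y : Fin n → ℝ}
    {u : EuclideanSpace ℝ (Fin d)} :
    IsLeastSquares x y u ↔ ∑ i, (y i - inner ℝ u (x i)) • x i = 0 := by
  constructor
  · intro h
    set z := ∑ i, (y i - inner ℝ u (x i)) • x i with hz
    set K := ∑ i, inner ℝ z (x i) ^ 2 with hK
    have hK0 : 0 ≤ K := Finset.sum_nonneg fun i _ => sq_nonneg _
    -- a step of length `t` in the direction of steepest descent
    have key : ∀ t : ℝ, 0 ≤ -2 * t * ‖z‖ ^ 2 + t ^ 2 * K := fun t => by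
      have h1 := h (u + t • z)
      rw [sumSquaredErrors_add, ← hz] at h1
      simp only [real_inner_smul_left, real_inner_self_eq_norm_sq, mul_pow, ← Finset.mul_sum,
        ← hK] at h1
      linarith
    have h2 := key (‖z‖ ^ 2 / (K + 1))
    have h3 : -2 * (‖z‖ ^ 2 / (K + 1)) * ‖z‖ ^ 2 + (‖z‖ ^ 2 / (K + 1)) ^ 2 * K
        = -((‖z‖ ^ 2) ^ 2 * (K + 2) / (K + 1) ^ 2) := by
      field_simp
      ring
    rw [h3] at h2
    have h4 : (‖z‖ ^ 2) ^ 2 = 0 := by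
      by_contra hne
      have : 0 < (‖z‖ ^ 2) ^ 2 * (K + 2) / (K + 1) ^ 2 := by positivity
      linarith
    simpa using h4
  · intro h v
    have h1 := sumSquaredErrors_add x y u (v - u)
    rw [h, add_sub_cancel, inner_zero_right] at h1
    have h2 : 0 ≤ ∑ i, inner ℝ (v - u) (x i) ^ 2 := Finset.sum_nonneg fun i _ => sq_nonneg _
    linarith

theorem leastSquares_normal (x : Fin n → EuclideanSpace ℝ (Fin d)) (y : Fin n → ℝ) :
    ∑ i, (y i - inner ℝ (leastSquares x y) (x i)) • x i = 0 :=
  isLeastSquares_iff.1 (existsUnique_minNorm x y).choose_spec.1.1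

theorem inner_starProjection_span_range {ι E : Type*} [NormedAddCommGroup E]
    [InnerProductSpace ℝ E] [FiniteDimensional ℝ E] (x : ι → E) (u : E) (i : ι) :
    inner ℝ ((Submodule.span ℝ (Set.range x)).starProjection u) (x i) = inner ℝ u (x i) := by
  have h := Submodule.starProjection_inner_eq_zero (K := Submodule.span ℝ (Set.range x)) u (x i)
    (Submodule.subset_span ⟨i, rfl⟩)
  rw [inner_sub_left, sub_eq_zero] at h
  exact h.symm

theorem leastSquares_mem_span (x : Fin n → EuclideanSpace ℝ (Fin d)) (y : Fin n → ℝ) :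
    leastSquares x y ∈ Submodule.span ℝ (Set.range x) := by
  set w := leastSquares x y
  have h1 : IsLeastSquares x y ((Submodule.span ℝ (Set.range x)).starProjection w) := by
    rw [isLeastSquares_iff]
    simp only [inner_starProjection_span_range]
    exact leastSquares_normal x y
  have h2 := (existsUnique_minNorm x y).choose_spec.1.2 _ h1
  rw [Submodule.mem_iff_norm_starProjection]
  exact le_antisymm (Submodule.norm_starProjection_apply_le _ _) h2

/-- The least squares solution of minimal norm is the solution of the normal equations in the
span of the inputs. -/
theorem eq_leastSquares {x : Fin n → EuclideanSpace ℝ (Fin d)} {y : Fin n → ℝ}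
    {u : EuclideanSpace ℝ (Fin d)} (hu : u ∈ Submodule.span ℝ (Set.range x))
    (hn : ∑ i, (y i - inner ℝ u (x i)) • x i = 0) : u = leastSquares x y := by
  set w := leastSquares x y
  have hmem : u - w ∈ Submodule.span ℝ (Set.range x) :=
    Submodule.sub_mem _ hu (leastSquares_mem_span x y)
  have h1 : ∑ i, inner ℝ (u - w) (x i) • x i = 0 := by
    have h2 := leastSquares_normal x y
    rw [← sub_eq_zero.2 (h2.trans hn.symm), ← Finset.sum_sub_distrib]
    refine Finset.sum_congr rfl fun i _ => ?_
    rw [← sub_smul, inner_sub_left]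
    congr 1
    ring
  have h3 : ∑ i, inner ℝ (u - w) (x i) ^ 2 = 0 := by
    have := congrArg (fun z => inner ℝ (u - w) z) h1
    simpa [inner_sum, inner_smul_right, sq] using this
  have h4 : ∀ i, inner ℝ (u - w) (x i) = 0 := fun i => by
    have := (Finset.sum_eq_zero_iff_of_nonneg fun i _ => sq_nonneg _).1 h3 i (Finset.mem_univ i)
    simpa using this
  have h5 : u - w ∈ (Submodule.span ℝ (Set.range x))ᗮ := by
    rw [Submodule.mem_orthogonal']
    intro z hz
    induction hz using Submodule.span_induction with
    | mem z hz => obtain ⟨i, rfl⟩ := hz; exact h4 i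
    | zero => simp
    | add a b _ _ ha hb => rw [inner_add_right, ha, hb, add_zero]
    | smul c a _ ha => rw [inner_smul_right, ha, mul_zero]
  exact sub_eq_zero.1 (Submodule.disjoint_def.1
    (Submodule.orthogonal_disjoint (Submodule.span ℝ (Set.range x))) _ hmem h5)

theorem leastSquares_add (x : Fin n → EuclideanSpace ℝ (Fin d)) (y y' : Fin n → ℝ) :
    leastSquares x (y + y') = leastSquares x y + leastSquares x y' := by
  refine (eq_leastSquares (Submodule.add_mem _ (leastSquares_mem_span x y)
    (leastSquares_mem_span x y')) ?_).symm
  rw [← add_zero (0 : EuclideanSpace ℝ (Fin d))]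
  nth_rw 1 [← leastSquares_normal x y, ← leastSquares_normal x y']
  rw [← Finset.sum_add_distrib]
  refine Finset.sum_congr rfl fun i _ => ?_
  rw [← add_smul, inner_add_left, Pi.add_apply]
  congr 1
  ring

theorem leastSquares_smul (x : Fin n → EuclideanSpace ℝ (Fin d)) (c : ℝ) (y : Fin n → ℝ) :
    leastSquares x (c • y) = c • leastSquares x y := by
  refine (eq_leastSquares (Submodule.smul_mem _ c (leastSquares_mem_span x y)) ?_).symm
  have h := congrArg (c • ·) (leastSquares_normal x y)
  simp only [smul_zero, Finset.smul_sum] at h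
  refine Eq.trans ?_ h
  refine Finset.sum_congr rfl fun i _ => ?_
  rw [smul_smul, real_inner_smul_left, Pi.smul_apply, smul_eq_mul]
  congr 1
  ring

/-- The `i`-th column of the pseudoinverse of the matrix with rows `x`: the least squares estimate
from the responses `eᵢ`. -/
noncomputable def pinvColumn (x : Fin n → EuclideanSpace ℝ (Fin d)) (i : Fin n) :
    EuclideanSpace ℝ (Fin d) :=
  leastSquares x (Pi.single i 1)

theorem leastSquares_eq_sum (x : Fin n → EuclideanSpace ℝ (Fin d)) (y : Fin n → ℝ) :
    leastSquares x y = ∑ i, y i • pinvColumn x i := by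
  let L : (Fin n → ℝ) →ₗ[ℝ] EuclideanSpace ℝ (Fin d) :=
    { toFun := leastSquares x
      map_add' := leastSquares_add x
      map_smul' := leastSquares_smul x }
  have h := LinearMap.pi_apply_eq_sum_univ L y
  refine h.trans (Finset.sum_congr rfl fun i _ => ?_)
  refine congrArg (y i • ·) (congrArg L (funext fun j => ?_))
  simp [Pi.single_apply, eq_comm]

/-- Without noise the estimate is the projection of the target to the span of the inputs. -/
theorem leastSquares_inner (x : Fin n → EuclideanSpace ℝ (Fin d)) (θ : EuclideanSpace ℝ (Fin d)) :
    leastSquares x (fun i => inner ℝ θ (x i))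
      = (Submodule.span ℝ (Set.range x)).starProjection θ := by
  refine (eq_leastSquares (Submodule.starProjection_apply_mem _ _) ?_).symm
  simp [inner_starProjection_span_range]

theorem leastSquares_linPredictor_add (x : Fin n → EuclideanSpace ℝ (Fin d))
    (θ : EuclideanSpace ℝ (Fin d)) (ε : Fin n → ℝ) :
    leastSquares x (fun i => linPredictor θ (x i) + ε i)
      = (Submodule.span ℝ (Set.range x)).starProjection θ + ∑ i, ε i • pinvColumn x i := by
  rw [← leastSquares_inner, ← leastSquares_eq_sum, ← leastSquares_add]
  rfl

theorem pinvColumn_map (Q : EuclideanSpace ℝ (Fin d) ≃ₗᵢ[ℝ] EuclideanSpace ℝ (Fin d))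
    (x : Fin n → EuclideanSpace ℝ (Fin d)) (i : Fin n) :
    pinvColumn (fun k => Q (x k)) i = Q (pinvColumn x i) := by
  refine (eq_leastSquares ?_ ?_).symm
  · have h := Submodule.apply_mem_span_image_of_mem_span Q.toLinearEquiv.toLinearMap
      (leastSquares_mem_span x (Pi.single i 1))
    rw [← Set.range_comp] at h
    exact h
  · have h := congrArg Q (leastSquares_normal x (Pi.single i 1))
    simpa [pinvColumn] using h

/-- Together with `pinvColumn_map`: rotating the inputs rotates the estimate. -/
theorem starProjection_span_map (Q : EuclideanSpace ℝ (Fin d) ≃ₗᵢ[ℝ] EuclideanSpace ℝ (Fin d))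
    (x : Fin n → EuclideanSpace ℝ (Fin d)) (u : EuclideanSpace ℝ (Fin d)) :
    (Submodule.span ℝ (Set.range fun k => Q (x k))).starProjection (Q u)
      = Q ((Submodule.span ℝ (Set.range x)).starProjection u) := by
  rw [← leastSquares_inner, ← leastSquares_inner, leastSquares_eq_sum, leastSquares_eq_sum, map_sum]
  simp [pinvColumn_map]

/-! ### Full rank -/

/-- The residuals vanish because the normal equations express them as a linear relation between
the inputs. -/
theorem inner_pinvColumn {x : Fin n → EuclideanSpace ℝ (Fin d)} (hx : LinearIndependent ℝ x)
    (i j : Fin n) : inner ℝ (pinvColumn x i) (x j) = (Pi.single i 1 : Fin n → ℝ) j := by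
  have h := Fintype.linearIndependent_iff.1 hx _ (leastSquares_normal x (Pi.single i 1)) j
  exact (sub_eq_zero.1 h).symm

/-- The columns of the pseudoinverse form the dual basis of the rows; so the length of a column is
the reciprocal of the distance of the corresponding row from the span of the others. -/
theorem norm_sq_pinvColumn_mul {m : ℕ} {x : Fin (m + 1) → EuclideanSpace ℝ (Fin d)}
    (hx : LinearIndependent ℝ x) (i : Fin (m + 1)) :
    ‖pinvColumn x i‖ ^ 2 * ‖(Submodule.span ℝ (Set.range
      fun j => x (i.succAbove j)))ᗮ.starProjection (x i)‖ ^ 2 = 1 := by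
  set V := Submodule.span ℝ (Set.range fun j => x (i.succAbove j)) with hV
  set p := pinvColumn x i with hp
  set q := Vᗮ.starProjection (x i) with hq
  have hpV : p ∈ Vᗮ := by
    rw [Submodule.mem_orthogonal']
    intro z hz
    induction hz using Submodule.span_induction with
    | mem z hz =>
      obtain ⟨j, rfl⟩ := hz
      simp [hp, inner_pinvColumn hx]
    | zero => simp
    | add a b _ _ ha hb => rw [inner_add_right, ha, hb, add_zero]
    | smul c a _ ha => rw [inner_smul_right, ha, mul_zero]
  have hproj : ∀ z ∈ Submodule.span ℝ (Set.range x), ∃ a : ℝ, Vᗮ.starProjection z = a • q := by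
    intro z hz
    induction hz using Submodule.span_induction with
    | mem z hz =>
      obtain ⟨j, rfl⟩ := hz
      rcases eq_or_ne j i with rfl | hji
      · exact ⟨1, by rw [one_smul]⟩
      · obtain ⟨k, rfl⟩ := Fin.exists_succAbove_eq hji
        refine ⟨0, ?_⟩
        rw [zero_smul]
        exact Submodule.starProjection_orthogonal_apply_eq_zero
          (Submodule.subset_span ⟨k, rfl⟩)
    | zero => exact ⟨0, by simp⟩
    | add a b _ _ ha hb =>
      obtain ⟨α, hα⟩ := ha
      obtain ⟨β, hβ⟩ := hb
      exact ⟨α + β, by rw [map_add, hα, hβ, add_smul]⟩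
    | smul c a _ ha =>
      obtain ⟨α, hα⟩ := ha
      exact ⟨c * α, by rw [map_smul, hα, smul_smul]⟩
  obtain ⟨a, ha⟩ := hproj p (leastSquares_mem_span _ _)
  rw [Submodule.starProjection_eq_self_iff.2 hpV] at ha
  have h1 : inner ℝ p q = 1 := by
    rw [hq, ← Submodule.inner_starProjection_left_eq_right,
      Submodule.starProjection_eq_self_iff.2 hpV, hp, inner_pinvColumn hx]
    simp
  rw [ha, real_inner_smul_left, real_inner_self_eq_norm_sq] at h1
  rw [ha, norm_smul, mul_pow, Real.norm_eq_abs, sq_abs]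
  calc a ^ 2 * ‖q‖ ^ 2 * ‖q‖ ^ 2 = (a * ‖q‖ ^ 2) ^ 2 := by ring
    _ = 1 := by rw [h1, one_pow]

/-- The columns of the matrix with rows `x`. -/
def columns (x : Fin n → EuclideanSpace ℝ (Fin d)) : Fin d → EuclideanSpace ℝ (Fin n) :=
  fun j => WithLp.toLp 2 fun i => x i j

theorem span_eq_top_of_linearIndependent_columns {x : Fin n → EuclideanSpace ℝ (Fin d)}
    (hx : LinearIndependent ℝ (columns x)) : Submodule.span ℝ (Set.range x) = ⊤ := by
  rw [← Submodule.orthogonal_eq_bot_iff, eq_bot_iff]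
  intro z hz
  rw [Submodule.mem_orthogonal'] at hz
  have h := Fintype.linearIndependent_iff.1 hx z (by
    ext i
    have := hz (x i) (Submodule.subset_span ⟨i, rfl⟩)
    simpa [columns, PiLp.inner_apply, mul_comm] using this)
  rw [Submodule.mem_bot]
  ext j
  simpa using h j

/-- The pseudoinverse of a transpose is the transpose of the pseudoinverse. -/
theorem pinvColumn_columns {x : Fin n → EuclideanSpace ℝ (Fin d)}
    (hx : LinearIndependent ℝ (columns x)) (i : Fin n) (j : Fin d) :
    pinvColumn x i j = pinvColumn (columns x) j i := by
  have hu : (WithLp.toLp 2 fun j => pinvColumn (columns x) j i : EuclideanSpace ℝ (Fin d))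
      = pinvColumn x i := by
    refine eq_leastSquares (by rw [span_eq_top_of_linearIndependent_columns hx]; trivial) ?_
    ext j
    -- the columns are reproduced by their own least squares problem
    have h := leastSquares_inner (columns x) (columns x j)
    rw [Submodule.starProjection_eq_self_iff.2 (Submodule.subset_span (Set.mem_range_self j)),
      leastSquares_eq_sum] at h
    have h2 := congrArg (fun z : EuclideanSpace ℝ (Fin n) => z i) h
    simp only [WithLp.ofLp_sum, Finset.sum_apply, WithLp.ofLp_smul, Pi.smul_apply,
      smul_eq_mul, PiLp.inner_apply, RCLike.inner_apply, conj_trivial] at h2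
    simp only [sub_smul, Finset.sum_sub_distrib, WithLp.ofLp_sub, WithLp.ofLp_sum, Pi.sub_apply,
      Finset.sum_apply, WithLp.ofLp_smul, Pi.smul_apply, smul_eq_mul, PiLp.inner_apply,
      RCLike.inner_apply, conj_trivial, WithLp.ofLp_zero, Pi.zero_apply, sub_eq_zero]
    simp only [columns] at h2
    simp only [Finset.sum_mul] at h2 ⊢
    rw [Finset.sum_comm] at h2
    simp only [Pi.single_apply, ite_mul, one_mul, zero_mul, Finset.sum_ite_eq', Finset.mem_univ,
      if_true]
    rw [← h2]
    exact Finset.sum_congr rfl fun k _ => Finset.sum_congr rfl fun l _ => by ring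
  exact (congrArg (fun z : EuclideanSpace ℝ (Fin d) => z j) hu).symm

theorem sum_norm_sq_pinvColumn_columns {x : Fin n → EuclideanSpace ℝ (Fin d)}
    (hx : LinearIndependent ℝ (columns x)) :
    ∑ i, ‖pinvColumn x i‖ ^ 2 = ∑ j, ‖pinvColumn (columns x) j‖ ^ 2 := by
  simp only [EuclideanSpace.real_norm_sq_eq]
  rw [Finset.sum_comm]
  simp only [pinvColumn_columns hx]

end LeastSquares

/-! ### Measurability of the estimate -/

section Ridge

open Filter Topology

variable {d n : ℕ}

/-- The second moment matrix `∑ᵢ xᵢ xᵢᵀ` of the inputs. -/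
def momentMatrix (x : Fin n → EuclideanSpace ℝ (Fin d)) : Matrix (Fin d) (Fin d) ℝ :=
  Matrix.of fun j k => ∑ i, x i j * x i k

/-- The operator `u ↦ ∑ᵢ ⟨u, xᵢ⟩ xᵢ`. -/
noncomputable def momentOperator (x : Fin n → EuclideanSpace ℝ (Fin d)) :
    EuclideanSpace ℝ (Fin d) →ₗ[ℝ] EuclideanSpace ℝ (Fin d) where
  toFun u := ∑ i, (inner ℝ u (x i) : ℝ) • x i
  map_add' u v := by simp [inner_add_left, add_smul, Finset.sum_add_distrib]
  map_smul' c u := by simp [real_inner_smul_left, mul_smul, Finset.smul_sum]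

theorem momentOperator_apply (x : Fin n → EuclideanSpace ℝ (Fin d))
    (u : EuclideanSpace ℝ (Fin d)) :
    momentOperator x u = ∑ i, (inner ℝ u (x i) : ℝ) • x i := rfl

theorem inner_momentOperator (x : Fin n → EuclideanSpace ℝ (Fin d))
    (u v : EuclideanSpace ℝ (Fin d)) :
    inner ℝ (momentOperator x u) v = ∑ i, (inner ℝ u (x i) : ℝ) * inner ℝ v (x i) := by
  simp only [momentOperator_apply, sum_inner, real_inner_smul_left]
  exact Finset.sum_congr rfl fun i _ => by rw [real_inner_comm v]

theorem momentOperator_isSymmetric (x : Fin n → EuclideanSpace ℝ (Fin d)) :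
    (momentOperator x).IsSymmetric := fun u v => by
  rw [inner_momentOperator, real_inner_comm, inner_momentOperator]
  exact Finset.sum_congr rfl fun i _ => mul_comm _ _

theorem inner_momentOperator_self_nonneg (x : Fin n → EuclideanSpace ℝ (Fin d))
    (u : EuclideanSpace ℝ (Fin d)) : 0 ≤ inner ℝ (momentOperator x u) u := by
  rw [inner_momentOperator]
  exact Finset.sum_nonneg fun i _ => mul_self_nonneg _

theorem toLp_momentMatrix_mulVec (x : Fin n → EuclideanSpace ℝ (Fin d))
    (u : EuclideanSpace ℝ (Fin d)) :
    WithLp.toLp 2 (Matrix.mulVec (momentMatrix x) u) = momentOperator x u := by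
  ext j
  simp only [momentOperator_apply, momentMatrix, Matrix.mulVec, dotProduct, Matrix.of_apply,
    WithLp.ofLp_sum, WithLp.ofLp_smul, Finset.sum_apply, Pi.smul_apply, PiLp.inner_apply,
    RCLike.inner_apply, conj_trivial, smul_eq_mul, Finset.sum_mul]
  rw [Finset.sum_comm]
  exact Finset.sum_congr rfl fun i _ => Finset.sum_congr rfl fun k _ => by ring

theorem span_range_le_range_momentOperator (x : Fin n → EuclideanSpace ℝ (Fin d)) :
    Submodule.span ℝ (Set.range x) ≤ LinearMap.range (momentOperator x) := by
  rw [← Submodule.orthogonal_orthogonal (LinearMap.range (momentOperator x)),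
    (momentOperator_isSymmetric x).orthogonal_range, Submodule.span_le]
  rintro _ ⟨i, rfl⟩
  rw [SetLike.mem_coe, Submodule.mem_orthogonal]
  intro u hu
  have h := inner_momentOperator x u u
  rw [LinearMap.mem_ker.1 hu, inner_zero_left] at h
  have := (Finset.sum_eq_zero_iff_of_nonneg fun i _ => mul_self_nonneg _).1 h.symm i
    (Finset.mem_univ i)
  simpa using this

/-- If `w` solves `T w = b` and lies in the range of the positive operator `T`, the solutions of
the regularised equations `(T + ε) u = b` are at distance `O(ε)` from `w`. -/
theorem norm_sub_le_of_ridge {E : Type*} [NormedAddCommGroup E] [InnerProductSpace ℝ E]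
    {T : E →ₗ[ℝ] E} (hT : ∀ u, 0 ≤ inner ℝ (T u) u) {ε : ℝ} (hε : 0 < ε) {u w z : E}
    (hw : w = T z) (hu : T u + ε • u = T w) : ‖u - w‖ ≤ ε * (2 * ‖z‖) := by
  set q := (u - w) + ε • z with hq
  have h1 : T q + ε • q = ε ^ 2 • z := by
    have h2 : T q + ε • q = (T u + ε • u) - T w - ε • w + ε • T z + ε ^ 2 • z := by
      simp only [hq, map_add, map_sub, map_smul]
      module
    rw [h2, hu, ← hw]
    module
  have h3 : ε * ‖q‖ ^ 2 ≤ ε ^ 2 * (‖z‖ * ‖q‖) := by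
    have h4 := congrArg (fun v => inner ℝ v q) h1
    simp only [inner_add_left, real_inner_smul_left, real_inner_self_eq_norm_sq] at h4
    have h5 := real_inner_le_norm z q
    have h6 := hT q
    nlinarith [mul_le_mul_of_nonneg_left h5 (sq_nonneg ε)]
  have h7 : ‖q‖ ≤ ε * ‖z‖ := by
    rcases (norm_nonneg q).eq_or_lt with h0 | h0
    · rw [← h0]; positivity
    · have : ε * ‖q‖ * ‖q‖ ≤ ε * ‖q‖ * (ε * ‖z‖) := by nlinarith
      exact le_of_mul_le_mul_left this (by positivity)
  have h8 : u - w = q - ε • z := by rw [hq]; abel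
  calc ‖u - w‖ ≤ ‖q‖ + ‖ε • z‖ := by rw [h8]; exact norm_sub_le _ _
    _ ≤ ε * ‖z‖ + ε * ‖z‖ := by
        rw [norm_smul, Real.norm_of_nonneg hε.le]
        exact add_le_add_left h7 _
    _ = ε * (2 * ‖z‖) := by ring

/-- The ridge regression estimate with regularisation `ε`. -/
noncomputable def ridge (x : Fin n → EuclideanSpace ℝ (Fin d)) (y : Fin n → ℝ) (ε : ℝ) :
    EuclideanSpace ℝ (Fin d) :=
  WithLp.toLp 2 (Matrix.mulVec (momentMatrix x + ε • (1 : Matrix (Fin d) (Fin d) ℝ))⁻¹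
    (∑ i, y i • x i : EuclideanSpace ℝ (Fin d)))

theorem momentOperator_ridge (x : Fin n → EuclideanSpace ℝ (Fin d)) (y : Fin n → ℝ) {ε : ℝ}
    (hε : 0 < ε) : momentOperator x (ridge x y ε) + ε • ridge x y ε = ∑ i, y i • x i := by
  have hpos : (momentMatrix x + ε • (1 : Matrix (Fin d) (Fin d) ℝ)).mulVec.Injective := by
    rw [← Matrix.coe_mulVecLin, ← LinearMap.ker_eq_bot, LinearMap.ker_eq_bot']
    intro v hv
    have h1 : momentOperator x (WithLp.toLp 2 v) + ε • WithLp.toLp 2 v = 0 := by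
      rw [← toLp_momentMatrix_mulVec]
      ext j
      have := congrFun hv j
      simpa [Matrix.add_mulVec, Matrix.smul_mulVec] using this
    have h2 := congrArg (fun u => inner ℝ u (WithLp.toLp 2 v : EuclideanSpace ℝ (Fin d))) h1
    simp only [inner_add_left, real_inner_smul_left, real_inner_self_eq_norm_sq,
      inner_zero_left] at h2
    have h3 := inner_momentOperator_self_nonneg x (WithLp.toLp 2 v)
    have h4 : ‖(WithLp.toLp 2 v : EuclideanSpace ℝ (Fin d))‖ ^ 2 = 0 := by
      have := sq_nonneg ‖(WithLp.toLp 2 v : EuclideanSpace ℝ (Fin d))‖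
      nlinarith
    simpa using h4
  have hdet := (Matrix.isUnit_iff_isUnit_det _).1 (Matrix.mulVec_injective_iff_isUnit.1 hpos)
  rw [← toLp_momentMatrix_mulVec]
  ext j
  have : Matrix.mulVec (momentMatrix x + ε • (1 : Matrix (Fin d) (Fin d) ℝ)) (ridge x y ε)
      = (∑ i, y i • x i : EuclideanSpace ℝ (Fin d)) := by
    rw [ridge, Matrix.mulVec_mulVec, Matrix.mul_nonsing_inv _ hdet, Matrix.one_mulVec]
  simpa [Matrix.add_mulVec, Matrix.smul_mulVec] using congrFun this j

theorem tendsto_ridge (x : Fin n → EuclideanSpace ℝ (Fin d)) (y : Fin n → ℝ) :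
    Tendsto (fun k : ℕ => ridge x y (1 / ((k : ℝ) + 1))) atTop (𝓝 (leastSquares x y)) := by
  obtain ⟨z, hz⟩ := span_range_le_range_momentOperator x (leastSquares_mem_span x y)
  have hw : momentOperator x (leastSquares x y) = ∑ i, y i • x i := by
    have h := leastSquares_normal x y
    simp only [sub_smul, Finset.sum_sub_distrib, sub_eq_zero] at h
    rw [momentOperator_apply, h]
  rw [tendsto_iff_norm_sub_tendsto_zero]
  refine squeeze_zero (fun _ => norm_nonneg _) (fun k => norm_sub_le_of_ridge
    (inner_momentOperator_self_nonneg x) (by positivity : (0 : ℝ) < 1 / ((k : ℝ) + 1)) hz.symm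
    ((momentOperator_ridge x y (by positivity)).trans hw.symm)) ?_
  simpa using (tendsto_one_div_add_atTop_nhds_zero_nat (𝕜 := ℝ)).mul_const (2 * ‖z‖)

theorem measurable_ridge (y : Fin n → ℝ) (ε : ℝ) :
    Measurable fun x : Fin n → EuclideanSpace ℝ (Fin d) => ridge x y ε := by
  have hM : Continuous fun x : Fin n → EuclideanSpace ℝ (Fin d) =>
      momentMatrix x + ε • (1 : Matrix (Fin d) (Fin d) ℝ) := by
    refine Continuous.add ?_ continuous_const
    exact continuous_matrix fun j k => by
      simp only [momentMatrix, Matrix.of_apply]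
      fun_prop
  have hinv : ∀ j k, Measurable fun x : Fin n → EuclideanSpace ℝ (Fin d) =>
      (momentMatrix x + ε • (1 : Matrix (Fin d) (Fin d) ℝ))⁻¹ j k := fun j k => by
    simp only [Matrix.inv_def, Matrix.smul_apply, Ring.inverse_eq_inv', smul_eq_mul]
    exact hM.matrix_det.measurable.inv.mul (hM.matrix_adjugate.matrix_elem j k).measurable
  refine (PiLp.continuous_toLp 2 _).measurable.comp (measurable_pi_lambda _ fun j => ?_)
  simp only [Matrix.mulVec, dotProduct]
  refine Finset.measurable_sum _ fun k _ => (hinv j k).mul (Continuous.measurable ?_)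
  fun_prop

/-- The least squares estimate is a pointwise limit of ridge estimates, which are given by matrix
inversion. -/
theorem measurable_leastSquares_left (y : Fin n → ℝ) :
    Measurable fun x : Fin n → EuclideanSpace ℝ (Fin d) => leastSquares x y :=
  measurable_of_tendsto_metrizable (fun k : ℕ => measurable_ridge y (1 / ((k : ℝ) + 1)))
    (tendsto_pi_nhds.2 fun x => tendsto_ridge x y)

@[fun_prop]
theorem measurable_pinvColumn (i : Fin n) :
    Measurable fun x : Fin n → EuclideanSpace ℝ (Fin d) => pinvColumn x i :=
  measurable_leastSquares_left _

@[fun_prop]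
theorem measurable_starProjection_span (θ : EuclideanSpace ℝ (Fin d)) :
    Measurable fun x : Fin n → EuclideanSpace ℝ (Fin d) =>
      (Submodule.span ℝ (Set.range x)).starProjection θ := by
  simp only [← leastSquares_inner, leastSquares_eq_sum]
  fun_prop

end Ridge

/-! ### The inverse square moment of a Gaussian vector -/

section InverseMoment

open Filter Topology Set
open scoped ENNReal

theorem map_orthogonalProjectionOnto_stdGaussian {E : Type*} [NormedAddCommGroup E]
    [InnerProductSpace ℝ E] [FiniteDimensional ℝ E] [MeasurableSpace E] [BorelSpace E]
    (W : Submodule ℝ E) :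
    (stdGaussian E).map W.orthogonalProjectionOnto = stdGaussian W := by
  refine Measure.ext_of_charFunDual ?_
  ext L
  have hL : ‖L ∘L W.orthogonalProjectionOnto‖ = ‖L‖ := by
    refine le_antisymm ?_ ?_
    · refine (L.opNorm_comp_le _).trans ?_
      have := W.orthogonalProjectionOnto_norm_le
      nlinarith [norm_nonneg L]
    · refine L.opNorm_le_bound (norm_nonneg _) fun z => ?_
      have := (L ∘L W.orthogonalProjectionOnto).le_opNorm z
      simpa using this
  rw [charFunDual_map, charFunDual_stdGaussian, charFunDual_stdGaussian, hL]

theorem integral_exp_neg_mul_sq_gaussianReal {t : ℝ} (ht : 0 ≤ t) :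
    ∫ x, Real.exp (-(t * x ^ 2)) ∂(gaussianReal 0 1) = (√(1 + 2 * t))⁻¹ := by
  rw [integral_gaussianReal_eq_integral_smul one_ne_zero]
  have h : ∀ x : ℝ, gaussianPDFReal 0 1 x • Real.exp (-(t * x ^ 2))
      = (√(2 * Real.pi))⁻¹ * Real.exp (-((1 + 2 * t) / 2) * x ^ 2) := fun x => by
    simp only [gaussianPDFReal, smul_eq_mul, NNReal.coe_one, mul_one, sub_zero]
    rw [mul_assoc, ← Real.exp_add]
    congr 2
    ring
  simp_rw [h]
  rw [integral_const_mul, integral_gaussian, ← Real.sqrt_inv, ← Real.sqrt_inv,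
    ← Real.sqrt_mul (by positivity)]
  congr 1
  field_simp

/-- The Laplace transform of the squared norm of a standard Gaussian vector. -/
theorem lintegral_exp_neg_mul_norm_sq_stdGaussian (E : Type*) [NormedAddCommGroup E]
    [InnerProductSpace ℝ E] [FiniteDimensional ℝ E] [MeasurableSpace E] [BorelSpace E]
    {t : ℝ} (ht : 0 ≤ t) :
    ∫⁻ z, ENNReal.ofReal (Real.exp (-(t * ‖z‖ ^ 2))) ∂(stdGaussian E)
      = ENNReal.ofReal ((√(1 + 2 * t))⁻¹ ^ Module.finrank ℝ E) := by
  have hint : Integrable (fun z : E => Real.exp (-(t * ‖z‖ ^ 2))) (stdGaussian E) := by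
    refine Integrable.of_bound (C := 1) (by fun_prop) (ae_of_all _ fun z => ?_)
    rw [Real.norm_of_nonneg (Real.exp_pos _).le, Real.exp_le_one_iff]
    have : 0 ≤ t * ‖z‖ ^ 2 := by positivity
    linarith
  rw [← ofReal_integral_eq_lintegral_ofReal hint (ae_of_all _ fun z => (Real.exp_pos _).le),
    stdGaussian, integral_map (Measurable.aemeasurable (by fun_prop)) (by fun_prop)]
  congr 1
  have h : ∀ x : Fin (Module.finrank ℝ E) → ℝ,
      Real.exp (-(t * ‖∑ i, x i • stdOrthonormalBasis ℝ E i‖ ^ 2))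
        = ∏ i, Real.exp (-(t * x i ^ 2)) := fun x => by
    rw [← Real.exp_sum, ← (stdOrthonormalBasis ℝ E).sum_sq_norm_inner_right,
      Finset.sum_neg_distrib, Finset.mul_sum]
    congr 2
    refine Finset.sum_congr rfl fun i _ => ?_
    rw [(stdOrthonormalBasis ℝ E).orthonormal.inner_right_fintype, Real.norm_eq_abs, sq_abs]
  simp_rw [h]
  rw [integral_fintype_prod_eq_prod (f := fun _ x => Real.exp (-(t * x ^ 2)))]
  simp [integral_exp_neg_mul_sq_gaussianReal ht]

theorem lintegral_exp_neg_mul {r : ℝ} (hr : 0 ≤ r) :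
    ∫⁻ t in Ioi (0 : ℝ), ENNReal.ofReal (Real.exp (-(t * r))) = (ENNReal.ofReal r)⁻¹ := by
  rcases hr.eq_or_lt with rfl | hr
  · simp
  · have hi := integrableOn_exp_mul_Ioi (neg_lt_zero.2 hr) 0
    have hv := integral_exp_mul_Ioi (neg_lt_zero.2 hr) 0
    have he : ∀ t : ℝ, Real.exp (-(t * r)) = Real.exp (-r * t) := fun t => by
      congr 1; ring
    simp_rw [he]
    rw [← ofReal_integral_eq_lintegral_ofReal hi (ae_of_all _ fun t => (Real.exp_pos _).le), hv,
      ← ENNReal.ofReal_inv_of_pos hr]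
    congr 1
    simp

theorem lintegral_inv_sqrt_pow_of_two_lt {k : ℕ} (hk : 2 < k) :
    ∫⁻ t in Ioi (0 : ℝ), ENNReal.ofReal ((√(1 + 2 * t))⁻¹ ^ k)
      = ENNReal.ofReal (1 / ((k : ℝ) - 2)) := by
  have hk' : (2 : ℝ) < k := by exact_mod_cast hk
  have hk0 : (k : ℝ) - 2 ≠ 0 := by linarith
  have hderiv : ∀ t ∈ Ici (0 : ℝ), HasDerivAt
      (fun t : ℝ => -(1 / ((k : ℝ) - 2)) * (1 + 2 * t) ^ (-(((k : ℝ) - 2) / 2)))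
      ((√(1 + 2 * t))⁻¹ ^ k) t := fun t ht => by
    have ht0 : (0 : ℝ) ≤ t := ht
    have hpos : 0 < 1 + 2 * t := by linarith
    have h1 : HasDerivAt (fun t : ℝ => 1 + 2 * t) 2 t := by
      simpa using ((hasDerivAt_id t).const_mul 2).const_add 1
    have h2 := (h1.rpow_const (p := -(((k : ℝ) - 2) / 2)) (Or.inl hpos.ne')).const_mul
      (-(1 / ((k : ℝ) - 2)))
    refine h2.congr_deriv ?_
    rw [← Real.sqrt_inv, Real.sqrt_eq_rpow, ← Real.rpow_natCast, ← Real.rpow_mul (by positivity),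
      Real.inv_rpow hpos.le, ← Real.rpow_neg hpos.le]
    rw [show -(((k : ℝ) - 2) / 2) - 1 = -(1 / 2 * (k : ℝ)) by ring]
    field_simp
  have hlim : Tendsto (fun t : ℝ => -(1 / ((k : ℝ) - 2)) * (1 + 2 * t) ^ (-(((k : ℝ) - 2) / 2)))
      atTop (𝓝 0) := by
    have h1 : Tendsto (fun t : ℝ => 1 + 2 * t) atTop atTop :=
      tendsto_atTop_add_const_left _ _ (tendsto_id.const_mul_atTop two_pos)
    have h2 := (tendsto_rpow_neg_atTop (y := ((k : ℝ) - 2) / 2) (by linarith)).comp h1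
    simpa using h2.const_mul (-(1 / ((k : ℝ) - 2)))
  have hnn : ∀ t ∈ Ioi (0 : ℝ), 0 ≤ (√(1 + 2 * t))⁻¹ ^ k := fun t _ => by positivity
  rw [← ofReal_integral_eq_lintegral_ofReal
    (integrableOn_Ioi_deriv_of_nonneg' hderiv hnn hlim)
    (ae_of_all _ fun t => by positivity), integral_Ioi_of_hasDerivAt_of_nonneg' hderiv hnn hlim]
  simp

theorem lintegral_inv_sqrt_pow_of_le_two {k : ℕ} (hk : k ≤ 2) :
    ∫⁻ t in Ioi (0 : ℝ), ENNReal.ofReal ((√(1 + 2 * t))⁻¹ ^ k) = ⊤ := by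
  have h1 : ∫⁻ t in Ioi (1 : ℝ), ENNReal.ofReal t⁻¹ = ⊤ := by
    by_contra hne
    refine not_integrableOn_Ioi_inv (a := 1) ⟨by fun_prop, ?_⟩
    rw [hasFiniteIntegral_iff_ofReal]
    · exact Ne.lt_top hne
    · filter_upwards [ae_restrict_mem measurableSet_Ioi] with t ht
      exact inv_nonneg.2 (zero_le_one.trans (mem_Ioi.1 ht).le)
  have h2 : ∫⁻ t in Ioi (1 : ℝ), ENNReal.ofReal (1 / 3) * ENNReal.ofReal t⁻¹ = ⊤ := by
    rw [lintegral_const_mul _ (by fun_prop), h1, ENNReal.mul_top]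
    simp
  rw [eq_top_iff, ← h2]
  refine (setLIntegral_mono' measurableSet_Ioi fun t ht => ?_).trans
    (lintegral_mono_set (Ioi_subset_Ioi zero_le_one))
  have ht1 : (1 : ℝ) < t := ht
  rw [← ENNReal.ofReal_mul (by norm_num)]
  refine ENNReal.ofReal_le_ofReal ?_
  have hs : (√(1 + 2 * t))⁻¹ ≤ 1 := inv_le_one_of_one_le₀ (Real.one_le_sqrt.2 (by linarith))
  calc 1 / 3 * t⁻¹ = (3 * t)⁻¹ := by rw [mul_inv]; norm_num
    _ ≤ (1 + 2 * t)⁻¹ := inv_anti₀ (by linarith) (by linarith)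
    _ = (√(1 + 2 * t))⁻¹ ^ 2 := by rw [inv_pow, Real.sq_sqrt (by linarith)]
    _ ≤ (√(1 + 2 * t))⁻¹ ^ k := pow_le_pow_of_le_one (by positivity) hs hk

/-- The expectation of `1 / ‖Z‖²` for `Z ∼ N(0, σ² I_k)`. -/
noncomputable def invMoment (σ : ℝ) (k : ℕ) : ℝ≥0∞ :=
  if 2 < k then ENNReal.ofReal (1 / (σ ^ 2 * ((k : ℝ) - 2))) else ⊤

/-- Write `1 / r = ∫₀^∞ exp (-t r) dt`, exchange the integrals, and integrate the Laplace
transform `(1 + 2t)^(-k/2)`. -/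
theorem lintegral_inv_norm_sq_stdGaussian (E : Type*) [NormedAddCommGroup E]
    [InnerProductSpace ℝ E] [FiniteDimensional ℝ E] [MeasurableSpace E] [BorelSpace E] :
    ∫⁻ z, (ENNReal.ofReal (‖z‖ ^ 2))⁻¹ ∂(stdGaussian E) = invMoment 1 (Module.finrank ℝ E) := by
  simp_rw [← lintegral_exp_neg_mul (sq_nonneg _)]
  rw [lintegral_lintegral_swap (Measurable.aemeasurable (by fun_prop)),
    setLIntegral_congr_fun measurableSet_Ioi (g := fun t => ENNReal.ofReal
      ((√(1 + 2 * t))⁻¹ ^ Module.finrank ℝ E)) fun t ht =>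
      lintegral_exp_neg_mul_norm_sq_stdGaussian E (mem_Ioi.1 ht).le]
  unfold invMoment
  split_ifs with h
  · rw [lintegral_inv_sqrt_pow_of_two_lt h, one_pow, one_mul]
  · exact lintegral_inv_sqrt_pow_of_le_two (not_lt.1 h)

theorem lintegral_inv_norm_sq_starProjection {d : ℕ} {σ : ℝ} (hσ : 0 < σ)
    (W : Submodule ℝ (EuclideanSpace ℝ (Fin d))) :
    ∫⁻ z, (ENNReal.ofReal (‖W.starProjection z‖ ^ 2))⁻¹ ∂(gaussianInput d σ)
      = invMoment σ (Module.finrank ℝ W) := by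
  have h1 : ∫⁻ z, (ENNReal.ofReal (‖W.starProjection z‖ ^ 2))⁻¹
      ∂(stdGaussian (EuclideanSpace ℝ (Fin d))) = invMoment 1 (Module.finrank ℝ W) := by
    rw [← lintegral_inv_norm_sq_stdGaussian, ← map_orthogonalProjectionOnto_stdGaussian W,
      lintegral_map (by fun_prop) (by fun_prop)]
    rfl
  rw [gaussianInput_eq_map_stdGaussian, lintegral_map (by fun_prop) (by fun_prop)]
  have h2 : ∀ z : EuclideanSpace ℝ (Fin d), (ENNReal.ofReal (‖W.starProjection (σ • z)‖ ^ 2))⁻¹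
      = ENNReal.ofReal ((σ ^ 2)⁻¹) * (ENNReal.ofReal (‖W.starProjection z‖ ^ 2))⁻¹ := fun z => by
    rw [map_smul, norm_smul, mul_pow, Real.norm_eq_abs, sq_abs, ENNReal.ofReal_mul (sq_nonneg σ),
      ENNReal.mul_inv (Or.inl (by positivity)) (Or.inl ENNReal.ofReal_ne_top),
      ENNReal.ofReal_inv_of_pos (by positivity)]
  simp_rw [h2]
  rw [lintegral_const_mul _ (by fun_prop), h1]
  unfold invMoment
  split_ifs with h
  · rw [← ENNReal.ofReal_mul (by positivity), one_pow, one_mul, one_div, one_div, mul_inv]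
  · rw [ENNReal.mul_top]
    simpa using hσ.ne'

end InverseMoment

/-! ### Symmetries and full rank of a Gaussian sample -/

section Sample

/-- The law of `n` independent inputs. -/
noncomputable def sampleLaw (d n : ℕ) (σ : ℝ) : Measure (Fin n → EuclideanSpace ℝ (Fin d)) :=
  Measure.pi fun _ => gaussianInput d σ

instance (d n : ℕ) (σ : ℝ) : IsProbabilityMeasure (sampleLaw d n σ) := by
  unfold sampleLaw
  infer_instance

theorem measurePreserving_gaussianInput {d : ℕ} (σ : ℝ)
    (Q : EuclideanSpace ℝ (Fin d) ≃ₗᵢ[ℝ] EuclideanSpace ℝ (Fin d)) :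
    MeasurePreserving Q (gaussianInput d σ) (gaussianInput d σ) where
  measurable := by fun_prop
  map_eq := by
    rw [gaussianInput_eq_map_stdGaussian]
    nth_rw 2 [← stdGaussian_map Q]
    rw [Measure.map_map (by fun_prop) (by fun_prop), Measure.map_map (by fun_prop) (by fun_prop)]
    congr 1
    ext1 z
    simp

theorem measurePreserving_sampleLaw {d : ℕ} (n : ℕ) (σ : ℝ)
    (Q : EuclideanSpace ℝ (Fin d) ≃ₗᵢ[ℝ] EuclideanSpace ℝ (Fin d)) :
    MeasurePreserving (fun x : Fin n → EuclideanSpace ℝ (Fin d) => fun k => Q (x k))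
      (sampleLaw d n σ) (sampleLaw d n σ) :=
  measurePreserving_pi _ _ fun _ => measurePreserving_gaussianInput σ Q

/-- A Gaussian vector avoids a proper subspace almost surely: a nonzero vector `v` orthogonal to
the subspace gives a nondegenerate real Gaussian `⟨v, ·⟩`, which does not vanish. -/
theorem ae_notMem_gaussianInput {d : ℕ} {σ : ℝ} (hσ : 0 < σ)
    {V : Submodule ℝ (EuclideanSpace ℝ (Fin d))} (hV : V ≠ ⊤) :
    ∀ᵐ z ∂(gaussianInput d σ), z ∉ V := by
  obtain ⟨v, hvV, hv0⟩ := Submodule.exists_mem_ne_zero_of_ne_bot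
    (mt (Submodule.orthogonal_eq_bot_iff (K := V)).1 hV)
  have hL0 : innerSL ℝ v ≠ 0 := fun h => hv0 (by
    have := congrArg (fun L => L v) h
    simpa using this)
  have hmap := IsGaussian.map_eq_gaussianReal (μ := stdGaussian (EuclideanSpace ℝ (Fin d)))
    (innerSL ℝ v)
  have hvar : (Var[innerSL ℝ v; stdGaussian (EuclideanSpace ℝ (Fin d))]).toNNReal ≠ 0 := by
    rw [variance_dual_stdGaussian, Ne, Real.toNNReal_eq_zero, not_le]
    have := norm_pos_iff.2 hL0
    positivity
  have h0 : ∀ᵐ z ∂(stdGaussian (EuclideanSpace ℝ (Fin d))), inner ℝ v z ≠ 0 := by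
    have := nullSingletonClass_gaussianReal (μ := (stdGaussian (EuclideanSpace ℝ (Fin d)))[innerSL ℝ v]) hvar
    rw [← hmap] at this
    have h1 : ∀ᵐ r ∂(Measure.map (innerSL ℝ v) (stdGaussian (EuclideanSpace ℝ (Fin d)))), r ≠ 0 :=
      Measure.ae_ne _ 0
    exact ae_of_ae_map (f := innerSL ℝ v) (p := fun r => r ≠ 0) (by fun_prop) h1
  rw [gaussianInput_eq_map_stdGaussian]
  refine (ae_map_iff (p := fun z => z ∉ V) (by fun_prop)
    V.closed_of_finiteDimensional.measurableSet.compl).2 ?_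
  filter_upwards [h0] with z hz hzV
  have hzV' : z ∈ V := (V.smul_mem_iff hσ.ne').1 hzV
  exact hz (Submodule.inner_left_of_mem_orthogonal hzV' hvV)

/-- Each new row avoids the span of the previous ones, which is a proper subspace. -/
theorem ae_linearIndependent_sampleLaw {d n : ℕ} (hn : n ≤ d) {σ : ℝ} (hσ : 0 < σ) :
    ∀ᵐ x ∂(sampleLaw d n σ), LinearIndependent ℝ x := by
  induction n with
  | zero => exact ae_of_all _ fun x => linearIndependent_empty_type
  | succ m ih =>
    have hmp := measurePreserving_piFinSuccAbove
      (fun _ : Fin (m + 1) => gaussianInput d σ) 0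
    have hmeas : MeasurableSet {p : EuclideanSpace ℝ (Fin d) × (Fin m → EuclideanSpace ℝ (Fin d)) |
        LinearIndependent ℝ (Fin.cons p.1 p.2 : Fin (m + 1) → EuclideanSpace ℝ (Fin d))} := by
      have hc : Continuous fun p : EuclideanSpace ℝ (Fin d) × (Fin m → EuclideanSpace ℝ (Fin d)) =>
          (Fin.cons p.1 p.2 : Fin (m + 1) → EuclideanSpace ℝ (Fin d)) := by fun_prop
      exact (isOpen_setOfPred_linearIndependent.preimage hc).measurableSet
    have hprod : ∀ᵐ p ∂((gaussianInput d σ).prod (sampleLaw d m σ)),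
        LinearIndependent ℝ (Fin.cons p.1 p.2 : Fin (m + 1) → EuclideanSpace ℝ (Fin d)) := by
      rw [Measure.ae_prod_iff_ae_ae hmeas,
        Measure.ae_ae_comm (p := fun z xs => LinearIndependent ℝ
          (Fin.cons z xs : Fin (m + 1) → EuclideanSpace ℝ (Fin d))) hmeas]
      filter_upwards [ih (by omega)] with xs hxs
      have hV : Submodule.span ℝ (Set.range xs) ≠ ⊤ := fun h => by
        have := finrank_span_eq_card hxs
        rw [h, finrank_top, finrank_euclideanSpace_fin, Fintype.card_fin] at this
        omega
      filter_upwards [ae_notMem_gaussianInput hσ hV] with z hz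
      exact hxs.finCons hz
    have := hmp.quasiMeasurePreserving.ae hprod
    filter_upwards [this] with x hx
    have hxe : (Fin.cons (x 0) (fun j => x (Fin.succAbove 0 j)) :
        Fin (m + 1) → EuclideanSpace ℝ (Fin d)) = x := by
      simpa [Fin.tail_def] using Fin.cons_self_tail x
    rw [← hxe]
    exact hx

end Sample

/-! ### The Frobenius norm of the pseudoinverse of a Gaussian matrix -/

section Frobenius

open scoped ENNReal

/-- The entries of the Gaussian matrix are independent with the same law, so its transpose is the
Gaussian matrix of the transposed shape. -/
theorem measurePreserving_columns (d n : ℕ) (σ : ℝ) :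
    MeasurePreserving columns (sampleLaw d n σ) (sampleLaw n d σ) := by
  set g : Measure ℝ := (gaussianReal 0 1).map (fun r => σ * r) with hg
  have : IsProbabilityMeasure g := Measure.isProbabilityMeasure_map (by fun_prop)
  have hinput : ∀ k : ℕ, gaussianInput k σ
      = (Measure.pi fun _ : Fin k => g).map (WithLp.toLp 2) := fun k => by
    rw [gaussianInput_eq_map_stdGaussian, ← map_pi_eq_stdGaussian,
      Measure.map_map (by fun_prop) (by fun_prop), hg, ← Measure.pi_map_pi (by fun_prop),
      Measure.map_map (by fun_prop) (by fun_prop)]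
    rfl
  have hsample : ∀ k l : ℕ, sampleLaw k l σ
      = ((Measure.pi fun _ : Fin l => Measure.pi fun _ : Fin k => g)).map
        (fun x i => WithLp.toLp 2 (x i)) := fun k l => by
    have : ∀ _ : Fin l, IsProbabilityMeasure
        ((Measure.pi fun _ : Fin k => g).map (WithLp.toLp 2)) := fun _ =>
      Measure.isProbabilityMeasure_map (by fun_prop)
    rw [sampleLaw, hinput, Measure.pi_map_pi (by fun_prop)]
  have hcurry : ∀ k l : ℕ, (Measure.pi fun _ : Fin l => Measure.pi fun _ : Fin k => g)
      = (Measure.pi fun _ : Fin l × Fin k => g).map (MeasurableEquiv.curry (Fin l) (Fin k) ℝ) :=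
    fun k l => by
      have h := Measure.infinitePi_map_curry (fun (_ : Fin l) (_ : Fin k) => g)
      simp only [Measure.infinitePi_eq_pi] at h
      exact h.symm
  have hswap : (Measure.pi fun _ : Fin d × Fin n => g)
      = (Measure.pi fun _ : Fin n × Fin d => g).map (fun x p => x p.swap) := by
    refine (Measure.pi_eq fun s hs => ?_)
    rw [Measure.map_apply (by fun_prop) (MeasurableSet.univ_pi hs)]
    have : (fun (x : Fin n × Fin d → ℝ) p => x p.swap) ⁻¹' Set.univ.pi s
        = Set.univ.pi fun q => s q.swap := by
      ext x
      simp only [Set.mem_preimage, Set.mem_univ_pi, Prod.forall, Prod.swap_prod_mk]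
      exact forall_comm
    rw [this, Measure.pi_pi]
    exact Fintype.prod_equiv (Equiv.prodComm _ _) _ _ fun _ => rfl
  have hmeas : Measurable (columns (d := d) (n := n)) := by
    unfold columns
    fun_prop
  refine ⟨hmeas, ?_⟩
  rw [hsample d n, hsample n d, hcurry, hcurry, hswap, Measure.map_map (by fun_prop) (by fun_prop),
    Measure.map_map (by fun_prop) (by fun_prop), Measure.map_map (by fun_prop) (by fun_prop),
    Measure.map_map (by fun_prop) (by fun_prop)]
  rfl

/-- By Fubini and `norm_sq_pinvColumn_mul`, each row contributes the inverse square moment of a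
Gaussian vector in the orthogonal complement of the other rows, of dimension `d - n + 1`. -/
theorem lintegral_sum_norm_sq_pinvColumn_of_le {d n : ℕ} (hn : n ≤ d) {σ : ℝ} (hσ : 0 < σ) :
    ∫⁻ x, ∑ i, ENNReal.ofReal (‖pinvColumn x i‖ ^ 2) ∂(sampleLaw d n σ)
      = n * invMoment σ (d - n + 1) := by
  rw [lintegral_finsetSum _ fun i _ => by fun_prop]
  suffices h : ∀ i : Fin n, ∫⁻ x, ENNReal.ofReal (‖pinvColumn x i‖ ^ 2) ∂(sampleLaw d n σ)
      = invMoment σ (d - n + 1) by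
    rw [Finset.sum_congr rfl fun i _ => h i]
    simp
  intro i
  obtain ⟨m, rfl⟩ : ∃ m, n = m + 1 := ⟨n - 1, by have := i.pos; omega⟩
  let F : EuclideanSpace ℝ (Fin d) × (Fin m → EuclideanSpace ℝ (Fin d)) → ℝ≥0∞ := fun p =>
    (ENNReal.ofReal (‖(Submodule.span ℝ (Set.range p.2))ᗮ.starProjection p.1‖ ^ 2))⁻¹
  have hF : Measurable F := by
    have h1 : Measurable fun p : EuclideanSpace ℝ (Fin d) × (Fin m → EuclideanSpace ℝ (Fin d)) =>
        (Submodule.span ℝ (Set.range p.2))ᗮ.starProjection p.1 := by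
      simp only [Submodule.starProjection_orthogonal_val, ← leastSquares_inner,
        leastSquares_eq_sum]
      fun_prop
    fun_prop
  have hmp := measurePreserving_piFinSuccAbove (fun _ : Fin (m + 1) => gaussianInput d σ) i
  have hae : ∀ᵐ x ∂(sampleLaw d (m + 1) σ), ENNReal.ofReal (‖pinvColumn x i‖ ^ 2)
      = F (MeasurableEquiv.piFinSuccAbove (fun _ => EuclideanSpace ℝ (Fin d)) i x) := by
    filter_upwards [ae_linearIndependent_sampleLaw hn hσ] with x hx
    have h1 := norm_sq_pinvColumn_mul hx i
    change _ = (ENNReal.ofReal (‖(Submodule.span ℝ (Set.range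
      fun j => x (i.succAbove j)))ᗮ.starProjection (x i)‖ ^ 2))⁻¹
    set q := ‖(Submodule.span ℝ (Set.range fun j => x (i.succAbove j)))ᗮ.starProjection (x i)‖ ^ 2
    have hq : 0 < q := lt_of_le_of_ne (sq_nonneg _) fun h => by simp [← h] at h1
    rw [← ENNReal.ofReal_inv_of_pos hq, eq_inv_of_mul_eq_one_left h1]
  rw [lintegral_congr_ae hae, sampleLaw, hmp.lintegral_comp hF,
    lintegral_prod_symm' _ hF]
  have hin : ∀ᵐ xs ∂(sampleLaw d m σ),
      ∫⁻ z, F (z, xs) ∂(gaussianInput d σ) = invMoment σ (d - (m + 1) + 1) := by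
    filter_upwards [ae_linearIndependent_sampleLaw (by omega : m ≤ d) hσ] with xs hxs
    simp only [F]
    rw [lintegral_inv_norm_sq_starProjection hσ]
    congr 1
    refine Submodule.finrank_add_finrank_orthogonal' ?_
    rw [finrank_span_eq_card hxs, finrank_euclideanSpace_fin, Fintype.card_fin]
    omega
  change ∫⁻ xs, ∫⁻ z, F (z, xs) ∂(gaussianInput d σ) ∂(sampleLaw d m σ) = _
  rw [lintegral_congr_ae hin]
  simp

theorem lintegral_sum_norm_sq_pinvColumn_of_ge {d n : ℕ} (hn : d ≤ n) {σ : ℝ} (hσ : 0 < σ) :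
    ∫⁻ x, ∑ i, ENNReal.ofReal (‖pinvColumn x i‖ ^ 2) ∂(sampleLaw d n σ)
      = d * invMoment σ (n - d + 1) := by
  rw [← lintegral_sum_norm_sq_pinvColumn_of_le hn hσ,
    ← (measurePreserving_columns d n σ).lintegral_comp (by fun_prop)]
  refine lintegral_congr_ae ?_
  filter_upwards [(measurePreserving_columns d n σ).quasiMeasurePreserving.ae
    (ae_linearIndependent_sampleLaw hn hσ)] with x hx
  rw [← ENNReal.ofReal_sum_of_nonneg fun _ _ => sq_nonneg _,
    ← ENNReal.ofReal_sum_of_nonneg fun _ _ => sq_nonneg _, sum_norm_sq_pinvColumn_columns hx]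

/-! ### Isotropy of the pseudoinverse -/

theorem norm_sq_starProjection_eq_sum {E : Type*} [NormedAddCommGroup E] [InnerProductSpace ℝ E]
    [FiniteDimensional ℝ E] (A : Submodule ℝ E) (v : E) :
    ‖A.starProjection v‖ ^ 2 = ∑ k, inner ℝ (stdOrthonormalBasis ℝ A k : E) v ^ 2 := by
  rw [Submodule.starProjection_apply, ← Submodule.coe_norm,
    ← (stdOrthonormalBasis ℝ A).sum_sq_norm_inner_right]
  refine Finset.sum_congr rfl fun k _ => ?_
  rw [Real.norm_eq_abs, sq_abs, Submodule.coe_inner, ← Submodule.starProjection_apply,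
    ← Submodule.inner_starProjection_left_eq_right,
    Submodule.starProjection_eq_self_iff.2 (stdOrthonormalBasis ℝ A k).2]

theorem exists_isometry_apply_eq {d : ℕ} {u u' : EuclideanSpace ℝ (Fin d)} (hu : ‖u‖ = 1)
    (hu' : ‖u'‖ = 1) :
    ∃ Q : EuclideanSpace ℝ (Fin d) ≃ₗᵢ[ℝ] EuclideanSpace ℝ (Fin d), Q u = u' :=
  ⟨(ℝ ∙ (u - u'))ᗮ.reflection, Submodule.reflection_sub (hu.trans hu'.symm)⟩

/-- Up to a constant, the mean squared norm of the projection of the pseudoinverse to a subspace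
is the dimension of the subspace: all directions contribute the same. -/
theorem exists_lintegral_sum_norm_sq_starProjection_pinvColumn (d n : ℕ) (σ : ℝ) :
    ∃ c : ℝ≥0∞, ∀ A : Submodule ℝ (EuclideanSpace ℝ (Fin d)),
      ∫⁻ x, ∑ i : Fin n, ENNReal.ofReal (‖A.starProjection (pinvColumn x i)‖ ^ 2)
        ∂(sampleLaw d n σ) = Module.finrank ℝ A * c := by
  let J : EuclideanSpace ℝ (Fin d) → ℝ≥0∞ := fun u =>
    ∫⁻ x, ∑ i : Fin n, ENNReal.ofReal (inner ℝ u (pinvColumn x i) ^ 2) ∂(sampleLaw d n σ)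
  have hJ : ∀ (Q : EuclideanSpace ℝ (Fin d) ≃ₗᵢ[ℝ] EuclideanSpace ℝ (Fin d)) u,
      J (Q u) = J u := fun Q u => by
    simp only [J]
    rw [← (measurePreserving_sampleLaw n σ Q).lintegral_comp (by fun_prop)]
    simp only [pinvColumn_map, LinearIsometryEquiv.inner_map_map]
  have hA : ∀ A : Submodule ℝ (EuclideanSpace ℝ (Fin d)),
      ∫⁻ x, ∑ i : Fin n, ENNReal.ofReal (‖A.starProjection (pinvColumn x i)‖ ^ 2)
        ∂(sampleLaw d n σ) = ∑ k, J (stdOrthonormalBasis ℝ A k : EuclideanSpace ℝ (Fin d)) :=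
    fun A => by
      simp only [J]
      rw [← lintegral_finsetSum _ fun k _ => by fun_prop]
      refine lintegral_congr fun x => ?_
      rw [Finset.sum_comm]
      refine Finset.sum_congr rfl fun i _ => ?_
      rw [norm_sq_starProjection_eq_sum, ENNReal.ofReal_sum_of_nonneg fun _ _ => sq_nonneg _]
  by_cases hu : ∃ u : EuclideanSpace ℝ (Fin d), ‖u‖ = 1
  · obtain ⟨u, hu⟩ := hu
    refine ⟨J u, fun A => ?_⟩
    have hk : ∀ k, J (stdOrthonormalBasis ℝ A k : EuclideanSpace ℝ (Fin d)) = J u := fun k => by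
      have h1 : ‖(stdOrthonormalBasis ℝ A k : EuclideanSpace ℝ (Fin d))‖ = 1 :=
        (stdOrthonormalBasis ℝ A).norm_eq_one k
      obtain ⟨Q, hQ⟩ := exists_isometry_apply_eq hu h1
      rw [← hQ, hJ]
    rw [hA]
    simp [hk]
  -- without unit vectors the space is trivial and both sides vanish
  · refine ⟨0, fun A => ?_⟩
    rw [hA, mul_zero]
    refine Finset.sum_eq_zero fun k _ => ?_
    exact absurd ⟨_, (stdOrthonormalBasis ℝ A).norm_eq_one k⟩ hu

theorem lintegral_sum_norm_sq_starProjection_pinvColumn {d n : ℕ} (σ : ℝ)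
    (A : Submodule ℝ (EuclideanSpace ℝ (Fin d))) :
    d * ∫⁻ x, ∑ i : Fin n, ENNReal.ofReal (‖A.starProjection (pinvColumn x i)‖ ^ 2)
        ∂(sampleLaw d n σ)
      = Module.finrank ℝ A
        * ∫⁻ x, ∑ i : Fin n, ENNReal.ofReal (‖pinvColumn x i‖ ^ 2) ∂(sampleLaw d n σ) := by
  obtain ⟨c, hc⟩ := exists_lintegral_sum_norm_sq_starProjection_pinvColumn d n σ
  have htop := hc ⊤
  rw [finrank_top, finrank_euclideanSpace_fin] at htop
  simp only [Submodule.starProjection_top, ContinuousLinearMap.id_apply] at htop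
  rw [htop, hc A]
  ring

end Frobenius

/-! ### Second moments of the projection to a random subspace -/

section ProjectionMoments

variable {d n : ℕ}

/-- The entry `⟨u, P v⟩` of the orthogonal projection `P` to the span of the rows `x`. -/
noncomputable def projEntry (u v : EuclideanSpace ℝ (Fin d))
    (x : Fin n → EuclideanSpace ℝ (Fin d)) : ℝ :=
  inner ℝ u ((Submodule.span ℝ (Set.range x)).starProjection v)

@[fun_prop]
theorem measurable_projEntry (u v : EuclideanSpace ℝ (Fin d)) :
    Measurable (projEntry u v : (Fin n → EuclideanSpace ℝ (Fin d)) → ℝ) := by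
  unfold projEntry
  fun_prop

theorem abs_projEntry_le (u v : EuclideanSpace ℝ (Fin d))
    (x : Fin n → EuclideanSpace ℝ (Fin d)) : |projEntry u v x| ≤ ‖u‖ * ‖v‖ :=
  (abs_real_inner_le_norm _ _).trans (mul_le_mul_of_nonneg_left
    (Submodule.norm_starProjection_apply_le _ _) (norm_nonneg _))

theorem integrable_projEntry_mul (μ : Measure (Fin n → EuclideanSpace ℝ (Fin d)))
    [IsFiniteMeasure μ] (u v u' v' : EuclideanSpace ℝ (Fin d)) :
    Integrable (fun x => projEntry u v x * projEntry u' v' x) μ := by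
  refine Integrable.of_bound
    ((measurable_projEntry u v).mul (measurable_projEntry u' v')).aestronglyMeasurable
    (‖u‖ * ‖v‖ * (‖u'‖ * ‖v'‖)) (ae_of_all _ fun x => ?_)
  rw [norm_mul]
  exact mul_le_mul (abs_projEntry_le u v x) (abs_projEntry_le u' v' x) (abs_nonneg _)
    (by positivity)

theorem projEntry_comm (u v : EuclideanSpace ℝ (Fin d))
    (x : Fin n → EuclideanSpace ℝ (Fin d)) : projEntry u v x = projEntry v u x := by
  rw [projEntry, ← Submodule.inner_starProjection_left_eq_right, real_inner_comm, projEntry]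

/-- The second moment of two entries of the projection. -/
noncomputable def projMoment (n : ℕ) (σ : ℝ) (u v u' v' : EuclideanSpace ℝ (Fin d)) : ℝ :=
  ∫ x, projEntry u v x * projEntry u' v' x ∂(sampleLaw d n σ)

theorem projMoment_map (n : ℕ) (σ : ℝ)
    (Q : EuclideanSpace ℝ (Fin d) ≃ₗᵢ[ℝ] EuclideanSpace ℝ (Fin d))
    (u v u' v' : EuclideanSpace ℝ (Fin d)) :
    projMoment n σ (Q u) (Q v) (Q u') (Q v') = projMoment n σ u v u' v' := by
  have hmp := measurePreserving_sampleLaw n σ Q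
  unfold projMoment
  conv_lhs => rw [← hmp.map_eq]
  rw [integral_map hmp.aemeasurable (Measurable.aestronglyMeasurable (by fun_prop))]
  simp only [projEntry, starProjection_span_map, LinearIsometryEquiv.inner_map_map]

theorem exists_isometry_apply_eq_pair {i j : Fin d} (hij : i ≠ j)
    {u v : EuclideanSpace ℝ (Fin d)} (hu : ‖u‖ = 1) (hv : ‖v‖ = 1) (huv : inner ℝ u v = (0 : ℝ)) :
    ∃ Q : EuclideanSpace ℝ (Fin d) ≃ₗᵢ[ℝ] EuclideanSpace ℝ (Fin d),
      Q (EuclideanSpace.basisFun (Fin d) ℝ i) = u ∧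
      Q (EuclideanSpace.basisFun (Fin d) ℝ j) = v := by
  classical
  let f : Fin d → EuclideanSpace ℝ (Fin d) := fun k => if k = i then u else v
  have hf : Orthonormal ℝ (({i, j} : Set (Fin d)).domRestrict f) := by
    constructor
    · rintro ⟨k, rfl | rfl⟩
      · simpa [f] using hu
      · simpa [f, hij.symm] using hv
    · rintro ⟨k, rfl | rfl⟩ ⟨l, rfl | rfl⟩ hkl
      · exact absurd rfl hkl
      · simpa [f, hij.symm] using huv
      · simpa [f, hij.symm, real_inner_comm] using huv
      · exact absurd rfl hkl
  obtain ⟨b, hb⟩ := hf.exists_orthonormalBasis_extension_of_card_eq (by simp)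
  refine ⟨(EuclideanSpace.basisFun (Fin d) ℝ).equiv b (Equiv.refl _), ?_, ?_⟩
  · rw [OrthonormalBasis.equiv_apply_basis, Equiv.refl_apply, hb i (by simp)]
    simp [f]
  · rw [OrthonormalBasis.equiv_apply_basis, Equiv.refl_apply, hb j (by simp)]
    simp [f, hij.symm]

theorem sum_projEntry_basisFun {x : Fin n → EuclideanSpace ℝ (Fin d)}
    (hx : LinearIndependent ℝ x) :
    ∑ i, projEntry (EuclideanSpace.basisFun (Fin d) ℝ i) (EuclideanSpace.basisFun (Fin d) ℝ i) x
      = n := by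
  set V := Submodule.span ℝ (Set.range x)
  have hproj : LinearMap.IsProj V (V.starProjection : _ →ₗ[ℝ] EuclideanSpace ℝ (Fin d)) :=
    ⟨fun u => Submodule.starProjection_apply_mem _ _,
      fun u hu => Submodule.starProjection_eq_self_iff.2 hu⟩
  have h := LinearMap.trace_eq_sum_inner
    (V.starProjection : _ →ₗ[ℝ] EuclideanSpace ℝ (Fin d)) (EuclideanSpace.basisFun (Fin d) ℝ)
  rw [hproj.trace, finrank_span_eq_card hx, Fintype.card_fin] at h
  exact h.symm

theorem sum_projEntry_basisFun_sq (u : EuclideanSpace ℝ (Fin d))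
    (x : Fin n → EuclideanSpace ℝ (Fin d)) :
    ∑ j, projEntry (EuclideanSpace.basisFun (Fin d) ℝ j) u x
      * projEntry (EuclideanSpace.basisFun (Fin d) ℝ j) u x = projEntry u u x := by
  set V := Submodule.span ℝ (Set.range x)
  have h1 := (EuclideanSpace.basisFun (Fin d) ℝ).sum_sq_inner_right (V.starProjection u)
  simp only [sq] at h1
  simp only [projEntry]
  rw [h1, ← sq, ← real_inner_self_eq_norm_sq, Submodule.inner_starProjection_left_eq_right,
    Submodule.starProjection_eq_self_iff.2 (Submodule.starProjection_apply_mem _ _)]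

/-- The mean square of an off-diagonal entry `⟨u, P v⟩`. By rotation invariance the second moments
of the entries are determined by `α = E P₁₁²`, `β = E P₁₂²` and `γ = E P₁₁ P₂₂`. Rotation by 45°
gives `γ = α - 2β`, while `P² = P` and `tr P = n` give `d α + d (d - 1) β = n` and
`d α + d (d - 1) γ = n²`. -/
theorem projMoment_of_orthonormal {σ : ℝ} (hσ : 0 < σ) (hd : 2 ≤ d) (hn : n ≤ d)
    {u v : EuclideanSpace ℝ (Fin d)} (hu : ‖u‖ = 1) (hv : ‖v‖ = 1) (huv : inner ℝ u v = (0 : ℝ)) :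
    projMoment n σ u v u v = (n * ((d : ℝ) - n)) / (d * ((d : ℝ) - 1) * (d + 2)) := by
  set e := EuclideanSpace.basisFun (Fin d) ℝ with he
  let i₀ : Fin d := ⟨0, by omega⟩
  let j₀ : Fin d := ⟨1, by omega⟩
  have hij₀ : i₀ ≠ j₀ := by simp [i₀, j₀]
  set α := projMoment n σ (e i₀) (e i₀) (e i₀) (e i₀) with hα
  set β := projMoment n σ (e i₀) (e j₀) (e i₀) (e j₀) with hβ
  have hβ' : ∀ {a b : EuclideanSpace ℝ (Fin d)}, ‖a‖ = 1 → ‖b‖ = 1 → inner ℝ a b = (0 : ℝ) →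
      projMoment n σ a b a b = β := fun {a b} ha hb hab => by
    obtain ⟨Q, rfl, rfl⟩ := exists_isometry_apply_eq_pair hij₀ ha hb hab
    rw [projMoment_map]
  have hα' : ∀ i, projMoment n σ (e i) (e i) (e i) (e i) = α := fun i => by
    obtain ⟨Q, hQ⟩ := exists_isometry_apply_eq (e.norm_eq_one i₀) (e.norm_eq_one i)
    rw [← hQ, projMoment_map]
  have hort : ∀ {i j : Fin d}, i ≠ j → inner ℝ (e i) (e j) = (0 : ℝ) := fun hij =>
    e.orthonormal.2 hij
  have hγ : ∀ {i j : Fin d}, i ≠ j →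
      projMoment n σ (e i) (e i) (e j) (e j) = α - 2 * β := fun {i j} hij => by
    -- `(eᵢ + eⱼ) / √2` and `(eᵢ - eⱼ) / √2` are orthonormal with entry `(Pᵢᵢ - Pⱼⱼ) / 2`
    have hs : (√2)⁻¹ * (√2)⁻¹ = (1 / 2 : ℝ) := by
      rw [← mul_inv, Real.mul_self_sqrt zero_le_two, one_div]
    have hi : inner ℝ (e i) (e i) = (1 : ℝ) := by
      rw [real_inner_self_eq_norm_sq, e.norm_eq_one, one_pow]
    have hj : inner ℝ (e j) (e j) = (1 : ℝ) := by
      rw [real_inner_self_eq_norm_sq, e.norm_eq_one, one_pow]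
    have hnorm : ∀ c : ℝ, c * c = 1 → ‖(√2)⁻¹ • (e i + c • e j)‖ = 1 := fun c hc => by
      have h1 : ‖(√2)⁻¹ • (e i + c • e j)‖ ^ 2 = 1 := by
        rw [← real_inner_self_eq_norm_sq]
        simp only [real_inner_smul_left, inner_smul_right, inner_add_left, inner_add_right, hi, hj,
          hort hij, hort hij.symm]
        linear_combination (1 + c * c) * hs + (1 / 2) * hc
      exact (pow_eq_one_iff_of_nonneg (norm_nonneg _) two_ne_zero).1 h1
    have hperp : inner ℝ ((√2)⁻¹ • (e i + (1 : ℝ) • e j)) ((√2)⁻¹ • (e i + (-1 : ℝ) • e j))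
        = (0 : ℝ) := by
      simp only [real_inner_smul_left, inner_smul_right, inner_add_left, inner_add_right, hi, hj,
        hort hij, hort hij.symm]
      ring
    have h := hβ' (hnorm 1 (by norm_num)) (hnorm (-1) (by norm_num)) hperp
    have hpt : ∀ x : Fin n → EuclideanSpace ℝ (Fin d),
        projEntry ((√2)⁻¹ • (e i + (1 : ℝ) • e j)) ((√2)⁻¹ • (e i + (-1 : ℝ) • e j)) x
        = 1 / 2 * (projEntry (e i) (e i) x - projEntry (e j) (e j) x) := fun x => by
      have hc := projEntry_comm (e i) (e j) x
      simp only [projEntry] at hc ⊢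
      simp only [map_smul, map_add, real_inner_smul_left, inner_smul_right, inner_add_left,
        inner_add_right, hc]
      linear_combination (inner ℝ (e i) ((Submodule.span ℝ (Set.range x)).starProjection (e i))
        - inner ℝ (e j) ((Submodule.span ℝ (Set.range x)).starProjection (e j))) * hs
    have hexp : ∀ x : Fin n → EuclideanSpace ℝ (Fin d),
        1 / 2 * (projEntry (e i) (e i) x - projEntry (e j) (e j) x)
          * (1 / 2 * (projEntry (e i) (e i) x - projEntry (e j) (e j) x))
        = 1 / 4 * (projEntry (e i) (e i) x * projEntry (e i) (e i) x
          + projEntry (e j) (e j) x * projEntry (e j) (e j) x)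
          - 1 / 2 * (projEntry (e i) (e i) x * projEntry (e j) (e j) x) := fun x => by ring
    have hI := integrable_projEntry_mul (sampleLaw d n σ)
    have hadd : Integrable (fun x => projEntry (e i) (e i) x * projEntry (e i) (e i) x
        + projEntry (e j) (e j) x * projEntry (e j) (e j) x) (sampleLaw d n σ) :=
      (hI _ _ _ _).add (hI _ _ _ _)
    rw [projMoment] at h
    simp only [hpt, hexp] at h
    rw [integral_sub (hadd.const_mul _) ((hI _ _ _ _).const_mul _),
      integral_const_mul, integral_const_mul, integral_add (hI _ _ _ _) (hI _ _ _ _)] at h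
    change 1 / 4 * (projMoment n σ (e i) (e i) (e i) (e i)
      + projMoment n σ (e j) (e j) (e j) (e j))
      - 1 / 2 * projMoment n σ (e i) (e i) (e j) (e j) = β at h
    rw [hα', hα'] at h
    linarith
  have hfull := ae_linearIndependent_sampleLaw hn hσ
  have hI := integrable_projEntry_mul (sampleLaw d n σ)
  have hsum1 : ∑ i, ∑ j, projMoment n σ (e j) (e i) (e j) (e i) = n := by
    have : ∑ i, ∑ j, projMoment n σ (e j) (e i) (e j) (e i)
        = ∫ x, ∑ i, ∑ j, projEntry (e j) (e i) x * projEntry (e j) (e i) x ∂(sampleLaw d n σ) := by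
      rw [integral_finsetSum _ fun i _ => integrable_finsetSum _ fun j _ => hI _ _ _ _]
      refine Finset.sum_congr rfl fun i _ => ?_
      rw [integral_finsetSum _ fun j _ => hI _ _ _ _]
      rfl
    rw [this]
    have hae : (fun x : Fin n → EuclideanSpace ℝ (Fin d) =>
        ∑ i, ∑ j, projEntry (e j) (e i) x * projEntry (e j) (e i) x)
        =ᵐ[sampleLaw d n σ] fun _ => (n : ℝ) := by
      filter_upwards [hfull] with x hx
      simp only [he, sum_projEntry_basisFun_sq]
      exact sum_projEntry_basisFun hx
    rw [integral_congr_ae hae]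
    simp
  have hsum2 : ∑ i, ∑ j, projMoment n σ (e i) (e i) (e j) (e j) = (n : ℝ) ^ 2 := by
    have : ∑ i, ∑ j, projMoment n σ (e i) (e i) (e j) (e j)
        = ∫ x, ∑ i, ∑ j, projEntry (e i) (e i) x * projEntry (e j) (e j) x ∂(sampleLaw d n σ) := by
      rw [integral_finsetSum _ fun i _ => integrable_finsetSum _ fun j _ => hI _ _ _ _]
      refine Finset.sum_congr rfl fun i _ => ?_
      rw [integral_finsetSum _ fun j _ => hI _ _ _ _]
      rfl
    rw [this]
    have hae : (fun x : Fin n → EuclideanSpace ℝ (Fin d) =>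
        ∑ i, ∑ j, projEntry (e i) (e i) x * projEntry (e j) (e j) x)
        =ᵐ[sampleLaw d n σ] fun _ => (n : ℝ) ^ 2 := by
      filter_upwards [hfull] with x hx
      rw [← Finset.sum_mul_sum, sum_projEntry_basisFun hx, sq]
    rw [integral_congr_ae hae]
    simp
  -- a symmetric double sum with constant diagonal and constant off-diagonal terms
  have hcount : ∀ (F : Fin d → Fin d → ℝ) (a b : ℝ), (∀ i, F i i = a) →
      (∀ i j, i ≠ j → F i j = b) → ∑ i, ∑ j, F i j = d * a + d * ((d : ℝ) - 1) * b := by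
    intro F a b ha hb
    have h1 : ∀ i j, F i j = b + if i = j then a - b else 0 := fun i j => by
      split_ifs with h
      · rw [h, ha]; ring
      · rw [hb i j h]; ring
    simp only [h1, Finset.sum_add_distrib, Finset.sum_ite_eq, Finset.mem_univ, if_true,
      Finset.sum_const, Finset.card_univ, Fintype.card_fin, nsmul_eq_mul]
    ring
  rw [hcount _ α β hα' fun i j hij => hβ' (e.norm_eq_one j) (e.norm_eq_one i) (hort hij.symm)]
    at hsum1
  rw [hcount _ α (α - 2 * β) hα' fun i j hij => hγ hij] at hsum2
  rw [hβ' hu hv huv]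
  have hd' : (2 : ℝ) ≤ d := by exact_mod_cast hd
  have hd1 : (0 : ℝ) < (d : ℝ) - 1 := by linarith
  rw [eq_div_iff (by positivity)]
  linear_combination (d : ℝ) * hsum1 - hsum2

/-- The mean squared length of the part in `A` of the projection of a vector orthogonal to `A`. -/
theorem integral_norm_sq_starProjection_span {σ : ℝ} (hσ : 0 < σ) (hd : 2 ≤ d) (hn : n ≤ d)
    (A : Submodule ℝ (EuclideanSpace ℝ (Fin d))) {θ : EuclideanSpace ℝ (Fin d)} (hθ : θ ∈ Aᗮ) :
    ∫ x : Fin n → EuclideanSpace ℝ (Fin d),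
        ‖A.starProjection ((Submodule.span ℝ (Set.range x)).starProjection θ)‖ ^ 2
        ∂(sampleLaw d n σ)
      = Module.finrank ℝ A
        * (‖θ‖ ^ 2 * ((n * ((d : ℝ) - n)) / (d * ((d : ℝ) - 1) * (d + 2)))) := by
  rcases eq_or_ne θ 0 with rfl | hθ0
  · simp
  have hnθ : ‖θ‖ ≠ 0 := norm_ne_zero_iff.2 hθ0
  have hpt : ∀ x : Fin n → EuclideanSpace ℝ (Fin d),
      ‖A.starProjection ((Submodule.span ℝ (Set.range x)).starProjection θ)‖ ^ 2
      = ∑ k, ‖θ‖ ^ 2 * (projEntry (stdOrthonormalBasis ℝ A k : EuclideanSpace ℝ (Fin d))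
          (‖θ‖⁻¹ • θ) x * projEntry (stdOrthonormalBasis ℝ A k : EuclideanSpace ℝ (Fin d))
          (‖θ‖⁻¹ • θ) x) := fun x => by
    rw [norm_sq_starProjection_eq_sum]
    refine Finset.sum_congr rfl fun k _ => ?_
    simp only [projEntry, map_smul, inner_smul_right]
    field_simp
  simp only [hpt]
  rw [integral_finsetSum _ fun k _ => (integrable_projEntry_mul _ _ _ _ _).const_mul _]
  have hk : ∀ k, ∫ x, ‖θ‖ ^ 2 * (projEntry (stdOrthonormalBasis ℝ A k : EuclideanSpace ℝ (Fin d))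
          (‖θ‖⁻¹ • θ) x * projEntry (stdOrthonormalBasis ℝ A k : EuclideanSpace ℝ (Fin d))
          (‖θ‖⁻¹ • θ) x) ∂(sampleLaw d n σ)
      = ‖θ‖ ^ 2 * ((n * ((d : ℝ) - n)) / (d * ((d : ℝ) - 1) * (d + 2))) := fun k => by
    rw [integral_const_mul]
    congr 1
    refine projMoment_of_orthonormal hσ hd hn ((stdOrthonormalBasis ℝ A).norm_eq_one k) ?_ ?_
    · rw [norm_smul, norm_inv, norm_norm, inv_mul_cancel₀ hnθ]
    · rw [inner_smul_right, Submodule.inner_right_of_mem_orthogonal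
        (stdOrthonormalBasis ℝ A k).2 hθ, mul_zero]
  simp [hk]

end ProjectionMoments

/-! ### Averaging over the noise -/

section Noise

open scoped ENNReal

theorem integral_eval_mul_eval_pi {n : ℕ} {lam : Measure ℝ} [IsProbabilityMeasure lam]
    {s : ℝ} (hmean : ∫ r, r ∂lam = 0) (hvar : ∫ r, r ^ 2 ∂lam = s ^ 2)
    (i j : Fin n) :
    ∫ ε, ε i * ε j ∂(Measure.pi fun _ : Fin n => lam) = if i = j then s ^ 2 else 0 := by
  split_ifs with h
  · subst h
    simp_rw [← sq]
    rw [← hvar]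
    exact integral_comp_eval (μ := fun _ : Fin n => lam) (i := i) (f := fun r : ℝ => r ^ 2)
      (by fun_prop)
  · have hind := (iIndepFun_pi (μ := fun _ : Fin n => lam) (X := fun _ r => r)
      fun _ => by fun_prop).indepFun h
    rw [hind.integral_fun_mul_eq_mul_integral (measurable_pi_apply i).aestronglyMeasurable
      (measurable_pi_apply j).aestronglyMeasurable]
    have : ∫ ε, ε i ∂(Measure.pi fun _ : Fin n => lam) = 0 := by
      rw [← hmean]
      exact integral_comp_eval (μ := fun _ : Fin n => lam) (i := i) (f := fun r : ℝ => r)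
        (by fun_prop)
    rw [this, zero_mul]

theorem lintegral_norm_sq_add_sum_smul {E : Type*} [NormedAddCommGroup E] [InnerProductSpace ℝ E]
    {n : ℕ} {lam : Measure ℝ} [IsProbabilityMeasure lam] {s : ℝ} (h2 : MemLp id 2 lam)
    (hmean : ∫ r, r ∂lam = 0) (hvar : ∫ r, r ^ 2 ∂lam = s ^ 2) (a : E) (b : Fin n → E) :
    ∫⁻ ε, ENNReal.ofReal (‖a + ∑ i, ε i • b i‖ ^ 2) ∂(Measure.pi fun _ : Fin n => lam)
      = ENNReal.ofReal (‖a‖ ^ 2) + ENNReal.ofReal (s ^ 2) * ∑ i, ENNReal.ofReal (‖b i‖ ^ 2) := by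
  set L := Measure.pi fun _ : Fin n => lam
  have hmem : ∀ i : Fin n, MemLp (fun ε : Fin n → ℝ => ε i) 2 L := fun i =>
    h2.comp_measurePreserving (measurePreserving_eval (fun _ : Fin n => lam) i)
  have hexp : ∀ ε : Fin n → ℝ, ‖a + ∑ i, ε i • b i‖ ^ 2
      = ‖a‖ ^ 2 + (∑ i, ε i * (2 * inner ℝ a (b i))
        + ∑ i, ∑ j, ε i * ε j * inner ℝ (b i) (b j)) := fun ε => by
    rw [norm_add_sq_real, ← real_inner_self_eq_norm_sq (∑ i, ε i • b i)]
    simp only [inner_sum, sum_inner, real_inner_smul_left, inner_smul_right, Finset.mul_sum]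
    rw [add_assoc]
    congr 2
    · exact Finset.sum_congr rfl fun i _ => by ring
    · rw [Finset.sum_comm]
      exact Finset.sum_congr rfl fun i _ => Finset.sum_congr rfl fun j _ => by ring
  have hi1 : ∀ i, Integrable (fun ε : Fin n → ℝ => ε i * (2 * inner ℝ a (b i))) L := fun i =>
    ((hmem i).integrable one_le_two).mul_const _
  have hi2 : ∀ i j, Integrable (fun ε : Fin n → ℝ => ε i * ε j * inner ℝ (b i) (b j)) L :=
    fun i j => ((hmem i).integrable_mul (hmem j)).mul_const _
  have hI1 : Integrable (fun ε : Fin n → ℝ => ∑ i, ε i * (2 * inner ℝ a (b i))) L :=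
    integrable_finsetSum _ fun i _ => hi1 i
  have hI2 : Integrable (fun ε : Fin n → ℝ => ∑ i, ∑ j, ε i * ε j * inner ℝ (b i) (b j)) L :=
    integrable_finsetSum _ fun i _ => integrable_finsetSum _ fun j _ => hi2 i j
  have hint : Integrable (fun ε : Fin n → ℝ => ‖a + ∑ i, ε i • b i‖ ^ 2) L := by
    simp only [hexp]
    exact (integrable_const _).add (hI1.add hI2)
  have hmean' : ∀ i : Fin n, ∫ ε : Fin n → ℝ, ε i ∂L = 0 := fun i => by
    rw [← hmean]
    exact integral_comp_eval (μ := fun _ : Fin n => lam) (i := i) (f := fun r : ℝ => r)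
      (by fun_prop)
  have hval : ∫ ε, ‖a + ∑ i, ε i • b i‖ ^ 2 ∂L = ‖a‖ ^ 2 + s ^ 2 * ∑ i, ‖b i‖ ^ 2 := by
    simp only [hexp]
    rw [integral_add (f := fun _ => ‖a‖ ^ 2) (g := fun ε : Fin n → ℝ =>
        ∑ i, ε i * (2 * inner ℝ a (b i)) + ∑ i, ∑ j, ε i * ε j * inner ℝ (b i) (b j))
        (integrable_const _) (hI1.add hI2), integral_add hI1 hI2,
      integral_finsetSum _ fun i _ => hi1 i,
      integral_finsetSum _ fun i _ => integrable_finsetSum _ fun j _ => hi2 i j]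
    simp only [integral_finsetSum _ fun j _ => hi2 _ j, integral_mul_const, hmean', zero_mul,
      Finset.sum_const_zero, zero_add, L, integral_eval_mul_eval_pi hmean hvar, ite_mul,
      Finset.sum_ite_eq, Finset.mem_univ, if_true, real_inner_self_eq_norm_sq, Finset.mul_sum,
      integral_const, probReal_univ, smul_eq_mul, one_mul]
  rw [← ofReal_integral_eq_lintegral_ofReal hint (ae_of_all _ fun _ => sq_nonneg _), hval,
    ENNReal.ofReal_add (sq_nonneg _) (by positivity), ENNReal.ofReal_mul (sq_nonneg s),
    ENNReal.ofReal_sum_of_nonneg fun _ _ => sq_nonneg _]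

/-- The inputs and the noise of an i.i.d. sample are independent samples. -/
theorem map_sample_eq_prod {Ω : Type*} [MeasurableSpace Ω] {P : Measure Ω}
    [IsProbabilityMeasure P] {d n : ℕ} {σX : ℝ} {θ : EuclideanSpace ℝ (Fin d)}
    {X : Ω → EuclideanSpace ℝ (Fin d)} {ξ Y : Ω → ℝ}
    (hX : HasLaw X (gaussianInput d σX) P) (hξ : AEMeasurable ξ P)
    (hXξ : IndepFun X ξ P) (hY : ∀ ω, Y ω = linPredictor θ (X ω) + ξ ω)
    {Xs : Fin n → Ω → EuclideanSpace ℝ (Fin d)} {Ys : Fin n → Ω → ℝ}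
    (h_law : ∀ i, IdentDistrib (fun ω => (Xs i ω, Ys i ω)) (fun ω => (X ω, Y ω)) P P)
    (h_indep : iIndepFun (fun i ω => (Xs i ω, Ys i ω)) P) :
    HasLaw (fun ω => ((fun i => Xs i ω), fun i => Ys i ω - linPredictor θ (Xs i ω)))
      ((sampleLaw d n σX).prod (Measure.pi fun _ : Fin n => P.map ξ)) P := by
  let Φ : EuclideanSpace ℝ (Fin d) × ℝ → EuclideanSpace ℝ (Fin d) × ℝ :=
    fun p => (p.1, p.2 - linPredictor θ p.1)
  have hΦ : Measurable Φ := by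
    unfold Φ linPredictor
    fun_prop
  have hm : ∀ i, AEMeasurable (fun ω => Φ (Xs i ω, Ys i ω)) P := fun i =>
    hΦ.comp_aemeasurable (h_law i).aemeasurable_fst
  have : IsProbabilityMeasure (P.map ξ) := Measure.isProbabilityMeasure_map hξ
  have hone : ∀ i, P.map (fun ω => Φ (Xs i ω, Ys i ω)) = (gaussianInput d σX).prod (P.map ξ) :=
    fun i => by
      have h1 := ((h_law i).comp hΦ).map_eq
      have h2 : Φ ∘ (fun ω => (X ω, Y ω)) = fun ω => (X ω, ξ ω) := by
        ext1 ω
        simp [Φ, hY]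
      rw [h2, (indepFun_iff_map_prod_eq_prod_map_map hX.aemeasurable hξ).1 hXξ, hX.map_eq] at h1
      exact h1
  have hpi : P.map (fun ω i => Φ (Xs i ω, Ys i ω))
      = Measure.pi fun _ : Fin n => (gaussianInput d σX).prod (P.map ξ) := by
    have h1 := (h_indep.comp (fun _ => Φ) fun _ => hΦ).map_fun_eq_pi_map hm
    simp only [hone] at h1
    exact h1
  have hmp := measurePreserving_arrowProdEquivProdArrow (EuclideanSpace ℝ (Fin d)) ℝ (Fin n)
    (fun _ => gaussianInput d σX) (fun _ => P.map ξ)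
  refine ⟨?_, ?_⟩
  · exact (aemeasurable_pi_lambda _ fun i => (hm i).fst).prodMk
      (aemeasurable_pi_lambda _ fun i => (hm i).snd)
  · have h1 := hmp.map_eq
    rw [← hpi, AEMeasurable.map_map_of_aemeasurable hmp.measurable.aemeasurable
      (aemeasurable_pi_lambda _ hm)] at h1
    exact h1

/-- The estimate as a function of the inputs and the noise. -/
noncomputable def noisyEstimate {d n : ℕ} (θ : EuclideanSpace ℝ (Fin d))
    (p : (Fin n → EuclideanSpace ℝ (Fin d)) × (Fin n → ℝ)) : EuclideanSpace ℝ (Fin d) :=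
  (Submodule.span ℝ (Set.range p.1)).starProjection θ + ∑ i, p.2 i • pinvColumn p.1 i

@[fun_prop]
theorem measurable_noisyEstimate {d n : ℕ} (θ : EuclideanSpace ℝ (Fin d)) :
    Measurable (noisyEstimate θ :
      (Fin n → EuclideanSpace ℝ (Fin d)) × (Fin n → ℝ) → EuclideanSpace ℝ (Fin d)) := by
  unfold noisyEstimate
  refine Measurable.add ((measurable_starProjection_span θ).comp measurable_fst) ?_
  fun_prop

/-- The bias and variance decomposition of the second moment of the estimate in a subspace. -/
theorem lintegral_norm_sq_starProjection_noisyEstimate {d n : ℕ} (σ : ℝ)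
    (θ : EuclideanSpace ℝ (Fin d)) {lam : Measure ℝ} [IsProbabilityMeasure lam] {s : ℝ}
    (h2 : MemLp id 2 lam) (hmean : ∫ r, r ∂lam = 0) (hvar : ∫ r, r ^ 2 ∂lam = s ^ 2)
    (A : Submodule ℝ (EuclideanSpace ℝ (Fin d))) :
    ∫⁻ p, ENNReal.ofReal (‖A.starProjection (noisyEstimate θ p)‖ ^ 2)
        ∂((sampleLaw d n σ).prod (Measure.pi fun _ : Fin n => lam))
      = ∫⁻ x, ENNReal.ofReal
          (‖A.starProjection ((Submodule.span ℝ (Set.range x)).starProjection θ)‖ ^ 2)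
          ∂(sampleLaw d n σ)
        + ENNReal.ofReal (s ^ 2) * ∫⁻ x, ∑ i : Fin n,
          ENNReal.ofReal (‖A.starProjection (pinvColumn x i)‖ ^ 2) ∂(sampleLaw d n σ) := by
  have hm : Measurable fun p : (Fin n → EuclideanSpace ℝ (Fin d)) × (Fin n → ℝ) =>
      ENNReal.ofReal (‖A.starProjection (noisyEstimate θ p)‖ ^ 2) := by fun_prop
  have hb : Measurable fun x : Fin n → EuclideanSpace ℝ (Fin d) => ENNReal.ofReal
      (‖A.starProjection ((Submodule.span ℝ (Set.range x)).starProjection θ)‖ ^ 2) := by fun_prop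
  have hv : Measurable fun x : Fin n → EuclideanSpace ℝ (Fin d) => ∑ i : Fin n,
      ENNReal.ofReal (‖A.starProjection (pinvColumn x i)‖ ^ 2) := by fun_prop
  have hin : ∀ x : Fin n → EuclideanSpace ℝ (Fin d),
      ∫⁻ ε, ENNReal.ofReal (‖A.starProjection (noisyEstimate θ (x, ε))‖ ^ 2)
        ∂(Measure.pi fun _ : Fin n => lam)
      = ENNReal.ofReal
          (‖A.starProjection ((Submodule.span ℝ (Set.range x)).starProjection θ)‖ ^ 2)
        + ENNReal.ofReal (s ^ 2) * ∑ i : Fin n,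
          ENNReal.ofReal (‖A.starProjection (pinvColumn x i)‖ ^ 2) := fun x => by
    have h := lintegral_norm_sq_add_sum_smul h2 hmean hvar
      (A.starProjection ((Submodule.span ℝ (Set.range x)).starProjection θ))
      fun i => A.starProjection (pinvColumn x i)
    rw [← h]
    refine lintegral_congr fun ε => ?_
    simp only [noisyEstimate, map_add, map_sum, map_smul]
  rw [lintegral_prod _ hm.aemeasurable, lintegral_congr hin, lintegral_add_left hb,
    lintegral_const_mul _ hv]

end Noise

/-! ### The second moment of the estimate in a subspace -/

section EstimateMoment

open scoped ENNReal

variable {d n : ℕ}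

theorem lintegral_bias_of_ge (hn : d ≤ n) {σ : ℝ} (hσ : 0 < σ)
    (A : Submodule ℝ (EuclideanSpace ℝ (Fin d))) {θ : EuclideanSpace ℝ (Fin d)} (hθ : θ ∈ Aᗮ) :
    ∫⁻ x : Fin n → EuclideanSpace ℝ (Fin d), ENNReal.ofReal
      (‖A.starProjection ((Submodule.span ℝ (Set.range x)).starProjection θ)‖ ^ 2)
      ∂(sampleLaw d n σ) = 0 := by
  rw [lintegral_eq_zero_iff (by fun_prop)]
  filter_upwards [(measurePreserving_columns d n σ).quasiMeasurePreserving.ae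
    (ae_linearIndependent_sampleLaw hn hσ)] with x hx
  rw [span_eq_top_of_linearIndependent_columns hx, Submodule.starProjection_top,
    ContinuousLinearMap.id_apply, (Submodule.starProjection_apply_eq_zero_iff _).2 hθ]
  simp

theorem lintegral_bias_of_le (hd : 2 ≤ d) (hn : n ≤ d) {σ : ℝ} (hσ : 0 < σ)
    (A : Submodule ℝ (EuclideanSpace ℝ (Fin d))) {θ : EuclideanSpace ℝ (Fin d)} (hθ : θ ∈ Aᗮ) :
    ∫⁻ x : Fin n → EuclideanSpace ℝ (Fin d), ENNReal.ofReal
      (‖A.starProjection ((Submodule.span ℝ (Set.range x)).starProjection θ)‖ ^ 2)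
      ∂(sampleLaw d n σ)
      = ENNReal.ofReal (Module.finrank ℝ A
        * (‖θ‖ ^ 2 * ((n * ((d : ℝ) - n)) / (d * ((d : ℝ) - 1) * (d + 2))))) := by
  rw [← integral_norm_sq_starProjection_span hσ hd hn A hθ, ofReal_integral_eq_lintegral_ofReal
    _ (ae_of_all _ fun _ => sq_nonneg _)]
  refine Integrable.of_bound (Measurable.aestronglyMeasurable (by fun_prop)) (‖θ‖ ^ 2)
    (ae_of_all _ fun x => ?_)
  rw [Real.norm_of_nonneg (sq_nonneg _)]
  exact pow_le_pow_left₀ (norm_nonneg _) ((A.norm_starProjection_apply_le _).trans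
    (Submodule.norm_starProjection_apply_le _ _)) 2

theorem lintegral_variance_of_ge (hn : d ≤ n) {σ : ℝ} (hσ : 0 < σ)
    (A : Submodule ℝ (EuclideanSpace ℝ (Fin d))) :
    ∫⁻ x, ∑ i : Fin n, ENNReal.ofReal (‖A.starProjection (pinvColumn x i)‖ ^ 2)
      ∂(sampleLaw d n σ) = Module.finrank ℝ A * invMoment σ (n - d + 1) := by
  have h := lintegral_sum_norm_sq_starProjection_pinvColumn (n := n) σ A
  rw [lintegral_sum_norm_sq_pinvColumn_of_ge hn hσ] at h
  rcases Nat.eq_zero_or_pos d with rfl | hd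
  · have : Subsingleton (EuclideanSpace ℝ (Fin 0)) := inferInstance
    have hA : Module.finrank ℝ A = 0 := Module.finrank_zero_of_subsingleton
    have h0 : ∀ v : EuclideanSpace ℝ (Fin 0), v = 0 := fun v => Subsingleton.elim _ _
    simp [hA, h0 (A.starProjection _)]
  · refine (ENNReal.mul_right_inj (Nat.cast_ne_zero.2 hd.ne') (ENNReal.natCast_ne_top d)).1 ?_
    rw [h]
    ring

theorem lintegral_variance_of_le (hd : 0 < d) (hn : n ≤ d) {σ : ℝ} (hσ : 0 < σ)
    (A : Submodule ℝ (EuclideanSpace ℝ (Fin d))) :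
    ∫⁻ x, ∑ i : Fin n, ENNReal.ofReal (‖A.starProjection (pinvColumn x i)‖ ^ 2)
      ∂(sampleLaw d n σ)
      = Module.finrank ℝ A * (n / d * invMoment σ (d - n + 1)) := by
  have h := lintegral_sum_norm_sq_starProjection_pinvColumn (n := n) σ A
  rw [lintegral_sum_norm_sq_pinvColumn_of_le hn hσ] at h
  have hd0 : (d : ℝ≥0∞) ≠ 0 := Nat.cast_ne_zero.2 hd.ne'
  refine (ENNReal.mul_right_inj hd0 (ENNReal.natCast_ne_top d)).1 ?_
  rw [h]
  calc (Module.finrank ℝ A : ℝ≥0∞) * (n * invMoment σ (d - n + 1))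
      = Module.finrank ℝ A * ((d * (n / d)) * invMoment σ (d - n + 1)) := by
        rw [ENNReal.mul_div_cancel hd0 (ENNReal.natCast_ne_top d)]
    _ = d * (Module.finrank ℝ A * (n / d * invMoment σ (d - n + 1))) := by ring

theorem lintegral_estimate_of_gt {σ : ℝ} (hσ : 0 < σ) (hn : d + 1 < n)
    {θ : EuclideanSpace ℝ (Fin d)} {lam : Measure ℝ} [IsProbabilityMeasure lam] {s : ℝ}
    (h2 : MemLp id 2 lam) (hmean : ∫ r, r ∂lam = 0) (hvar : ∫ r, r ^ 2 ∂lam = s ^ 2)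
    (A : Submodule ℝ (EuclideanSpace ℝ (Fin d))) (hθ : θ ∈ Aᗮ) :
    ∫⁻ p, ENNReal.ofReal (‖A.starProjection (noisyEstimate θ p)‖ ^ 2)
        ∂((sampleLaw d n σ).prod (Measure.pi fun _ : Fin n => lam))
      = ENNReal.ofReal (s ^ 2 * (Module.finrank ℝ A * (1 / (σ ^ 2 * ((n : ℝ) - d - 1))))) := by
  have hn' : (d : ℝ) + 1 < n := by exact_mod_cast hn
  rw [lintegral_norm_sq_starProjection_noisyEstimate σ θ h2 hmean hvar A,
    lintegral_bias_of_ge (by omega) hσ A hθ, lintegral_variance_of_ge (by omega) hσ, zero_add,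
    invMoment, if_pos (by omega), ← ENNReal.ofReal_natCast,
    ← ENNReal.ofReal_mul (Nat.cast_nonneg _), ← ENNReal.ofReal_mul (sq_nonneg s)]
  congr 5
  rw [Nat.cast_add, Nat.cast_sub (by omega)]
  push_cast
  ring

theorem lintegral_estimate_of_lt {σ : ℝ} (hσ : 0 < σ) (hn : n + 1 < d)
    {θ : EuclideanSpace ℝ (Fin d)} {lam : Measure ℝ} [IsProbabilityMeasure lam] {s : ℝ}
    (h2 : MemLp id 2 lam) (hmean : ∫ r, r ∂lam = 0) (hvar : ∫ r, r ^ 2 ∂lam = s ^ 2)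
    (A : Submodule ℝ (EuclideanSpace ℝ (Fin d))) (hθ : θ ∈ Aᗮ) :
    ∫⁻ p, ENNReal.ofReal (‖A.starProjection (noisyEstimate θ p)‖ ^ 2)
        ∂((sampleLaw d n σ).prod (Measure.pi fun _ : Fin n => lam))
      = ENNReal.ofReal (Module.finrank ℝ A
          * (‖θ‖ ^ 2 * ((n * ((d : ℝ) - n)) / (d * ((d : ℝ) - 1) * (d + 2))))
        + s ^ 2 * (Module.finrank ℝ A * (n / d * (1 / (σ ^ 2 * ((d : ℝ) - n - 1)))))) := by
  have hn' : (n : ℝ) + 1 < d := by exact_mod_cast hn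
  have hd : (0 : ℝ) < d := lt_of_le_of_lt (by positivity) hn'
  have hk : (0 : ℝ) < (d : ℝ) - n - 1 := by linarith
  have hn0 : (0 : ℝ) ≤ n := Nat.cast_nonneg n
  have hc : (((d - n + 1 : ℕ) : ℝ) - 2) = (d : ℝ) - n - 1 := by
    rw [Nat.cast_add, Nat.cast_sub (by omega)]
    push_cast
    ring
  have hb : (0 : ℝ) ≤ (n * ((d : ℝ) - n)) / (d * ((d : ℝ) - 1) * (d + 2)) :=
    div_nonneg (mul_nonneg hn0 (by linarith))
      (mul_nonneg (mul_nonneg hd.le (by linarith)) (by linarith))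
  rw [lintegral_norm_sq_starProjection_noisyEstimate σ θ h2 hmean hvar A,
    lintegral_bias_of_le (by omega) (by omega) hσ A hθ,
    lintegral_variance_of_le (by omega) (by omega) hσ,
    invMoment, if_pos (by omega), hc, ← ENNReal.ofReal_natCast, ← ENNReal.ofReal_natCast n,
    ← ENNReal.ofReal_natCast d, ← ENNReal.ofReal_div_of_pos hd,
    ← ENNReal.ofReal_mul (by positivity), ← ENNReal.ofReal_mul (by positivity),
    ← ENNReal.ofReal_mul (by positivity), ← ENNReal.ofReal_add (by positivity) (by positivity)]

/-- Near the interpolation threshold the variance is infinite in every nonzero subspace. -/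
theorem lintegral_estimate_eq_top {σ : ℝ} (hσ : 0 < σ) (hn : n ≠ 0) (hdn : d ≤ n + 1)
    (hnd : n ≤ d + 1) (θ : EuclideanSpace ℝ (Fin d)) {lam : Measure ℝ} [IsProbabilityMeasure lam]
    {s : ℝ} (hs : 0 < s) (h2 : MemLp id 2 lam) (hmean : ∫ r, r ∂lam = 0)
    (hvar : ∫ r, r ^ 2 ∂lam = s ^ 2) (A : Submodule ℝ (EuclideanSpace ℝ (Fin d)))
    (hA : Module.finrank ℝ A ≠ 0) :
    ∫⁻ p, ENNReal.ofReal (‖A.starProjection (noisyEstimate θ p)‖ ^ 2)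
        ∂((sampleLaw d n σ).prod (Measure.pi fun _ : Fin n => lam)) = ⊤ := by
  have hA' : (Module.finrank ℝ A : ℝ≥0∞) ≠ 0 := Nat.cast_ne_zero.2 hA
  have htop : ∫⁻ x, ∑ i : Fin n, ENNReal.ofReal (‖A.starProjection (pinvColumn x i)‖ ^ 2)
      ∂(sampleLaw d n σ) = ⊤ := by
    rcases le_total d n with h | h
    · rw [lintegral_variance_of_ge h hσ, invMoment, if_neg (by omega), ENNReal.mul_top hA']
    · have hd : 0 < d := by omega
      have hq : (n : ℝ≥0∞) / d ≠ 0 :=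
        ENNReal.div_ne_zero.2 ⟨Nat.cast_ne_zero.2 hn, ENNReal.natCast_ne_top d⟩
      rw [lintegral_variance_of_le hd h hσ, invMoment, if_neg (by omega), ENNReal.mul_top hq,
        ENNReal.mul_top hA']
  rw [lintegral_norm_sq_starProjection_noisyEstimate σ θ h2 hmean hvar A, htop, ENNReal.mul_top,
    add_top]
  simpa using hs.ne'

theorem lintegral_norm_sq_noisyEstimate_ne_top {σ : ℝ} (hσ : 0 < σ) (hn : d + 1 < n ∨ n + 1 < d)
    (θ : EuclideanSpace ℝ (Fin d)) {lam : Measure ℝ} [IsProbabilityMeasure lam] {s : ℝ}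
    (h2 : MemLp id 2 lam) (hmean : ∫ r, r ∂lam = 0) (hvar : ∫ r, r ^ 2 ∂lam = s ^ 2) :
    ∫⁻ p, ENNReal.ofReal (‖noisyEstimate θ p‖ ^ 2)
        ∂((sampleLaw d n σ).prod (Measure.pi fun _ : Fin n => lam)) ≠ ⊤ := by
  have h := lintegral_norm_sq_starProjection_noisyEstimate (n := n) σ θ h2 hmean hvar ⊤
  simp only [Submodule.starProjection_top, ContinuousLinearMap.id_apply] at h
  rw [h, ENNReal.add_ne_top]
  constructor
  · refine ne_top_of_le_ne_top (b := ENNReal.ofReal (‖θ‖ ^ 2)) ENNReal.ofReal_ne_top ?_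
    calc _ ≤ ∫⁻ _ : Fin n → EuclideanSpace ℝ (Fin d), ENNReal.ofReal (‖θ‖ ^ 2)
          ∂(sampleLaw d n σ) := lintegral_mono fun x => ENNReal.ofReal_le_ofReal
            (pow_le_pow_left₀ (norm_nonneg _) (Submodule.norm_starProjection_apply_le _ _) 2)
      _ = _ := by simp
  · refine ENNReal.mul_ne_top ENNReal.ofReal_ne_top ?_
    rcases hn with hn | hn
    · rw [lintegral_sum_norm_sq_pinvColumn_of_ge (by omega) hσ, invMoment, if_pos (by omega)]
      exact ENNReal.mul_ne_top (ENNReal.natCast_ne_top d) ENNReal.ofReal_ne_top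
    · rw [lintegral_sum_norm_sq_pinvColumn_of_le (by omega) hσ, invMoment, if_pos (by omega)]
      exact ENNReal.mul_ne_top (ENNReal.natCast_ne_top n) ENNReal.ofReal_ne_top

end EstimateMoment

/-! ### Generalisation gaps -/

theorem integrable_and_integral_eq_of_lintegral_ofReal {Ω : Type*} [MeasurableSpace Ω]
    {P : Measure Ω} {f : Ω → ℝ} {V : ℝ} (hf : AEMeasurable f P) (h0 : ∀ ω, 0 ≤ f ω) (hV : 0 ≤ V)
    (h : ∫⁻ ω, ENNReal.ofReal (f ω) ∂P = ENNReal.ofReal V) :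
    Integrable f P ∧ ∫ ω, f ω ∂P = V := by
  constructor
  · refine ⟨hf.aestronglyMeasurable, ?_⟩
    rw [hasFiniteIntegral_iff_ofReal (ae_of_all _ h0), h]
    exact ENNReal.ofReal_lt_top
  · rw [integral_eq_lintegral_of_nonneg_ae (ae_of_all _ h0) hf.aestronglyMeasurable, h,
      ENNReal.toReal_ofReal hV]

/-- Replacing the second predictor by one of smaller nonnegative risk keeps the gap integrable and
does not decrease its mean. -/
theorem integrable_sub_and_integral_le {Ω : Type*} [MeasurableSpace Ω] {P : Measure Ω}
    {f g k : Ω → ℝ} (hf : Integrable f P) (hfg : Integrable (fun ω => f ω - g ω) P)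
    (hk : AEMeasurable k P) (hk0 : ∀ ω, 0 ≤ k ω) (hkg : ∀ᵐ ω ∂P, k ω ≤ g ω) :
    Integrable (fun ω => f ω - k ω) P ∧ ∫ ω, f ω - k ω ∂P ≥ ∫ ω, f ω - g ω ∂P := by
  have hg : Integrable g P := by
    have := hf.sub hfg
    refine this.congr (ae_of_all _ fun ω => ?_)
    simp
  have hki : Integrable k P := hg.mono' hk.aestronglyMeasurable (by
    filter_upwards [hkg] with ω hω
    rwa [Real.norm_of_nonneg (hk0 ω)])
  refine ⟨hf.sub hki, integral_mono_ae hfg (hf.sub hki) ?_⟩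
  filter_upwards [hkg] with ω hω
  linarith

theorem risk_nonneg {Ω : Type*} [MeasurableSpace Ω] {d : ℕ} (P : Measure Ω)
    (X : Ω → EuclideanSpace ℝ (Fin d)) (Y : Ω → ℝ) (f : EuclideanSpace ℝ (Fin d) → ℝ) :
    0 ≤ risk P X Y f :=
  integral_nonneg fun _ => sq_nonneg _

/-- If the invariant predictors are everything, or there are no examples, the estimate is
invariant. -/
theorem isInvariantPredictor_leastSquares {d n : ℕ} {G : Type*} [Group G]
    (φ : G →* (EuclideanSpace ℝ (Fin d) ≃ₗᵢ[ℝ] EuclideanSpace ℝ (Fin d)))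
    (x : Fin n → EuclideanSpace ℝ (Fin d)) (y : Fin n → ℝ)
    (h : n = 0 ∨ Module.finrank ℝ (symmetricSubspace φ)ᗮ = 0) :
    IsInvariantPredictor φ (linPredictor (leastSquares x y)) := by
  rw [← mem_symmetricSubspace_iff]
  rcases h with rfl | h
  · rw [leastSquares_eq_sum]
    simp
  · rw [Submodule.finrank_eq_zero, Submodule.orthogonal_eq_bot_iff] at h
    rw [h]
    trivial

end InvariantRegression

theorem mainTheorem4
    (d n : ℕ)
    {G : Type*} [Group G] [TopologicalSpace G] [IsTopologicalGroup G] [CompactSpace G] [T2Space G]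
    [SecondCountableTopology G] [MeasurableSpace G] [BorelSpace G]
    (ν : Measure G) [ν.IsHaarMeasure] [IsProbabilityMeasure ν]
    (φ : G →* (EuclideanSpace ℝ (Fin d) ≃ₗᵢ[ℝ] EuclideanSpace ℝ (Fin d)))
    (hφ : Measurable fun p : G × EuclideanSpace ℝ (Fin d) => φ p.1 p.2)
    {Ω : Type*} [MeasurableSpace Ω] (P : Measure Ω) [IsProbabilityMeasure P]
    (σX σξ : ℝ) (hσX : 0 < σX) (hσξ : 0 ≤ σξ)
    (θ : EuclideanSpace ℝ (Fin d))
    (hθ : InvariantRegression.IsInvariantPredictor φ (InvariantRegression.linPredictor θ))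
    (X : Ω → EuclideanSpace ℝ (Fin d)) (ξ Y : Ω → ℝ)
    (hX : HasLaw X (InvariantRegression.gaussianInput d σX) P)
    (hξ : MemLp ξ 2 P) (hξ_mean : ∫ ω, ξ ω ∂P = 0) (hξ_var : Var[ξ; P] = σξ ^ 2)
    (hXξ : IndepFun X ξ P)
    (hY : ∀ ω, Y ω = InvariantRegression.linPredictor θ (X ω) + ξ ω)
    -- the training sample
    (Xs : Fin n → Ω → EuclideanSpace ℝ (Fin d)) (Ys : Fin n → Ω → ℝ)
    (h_law : ∀ i, IdentDistrib (fun ω => (Xs i ω, Ys i ω)) (fun ω => (X ω, Y ω)) P P)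
    (h_indep : iIndepFun (fun i ω => (Xs i ω, Ys i ω)) P)
    (h_test : IndepFun (fun ω => (X ω, Y ω)) (fun ω i => (Xs i ω, Ys i ω)) P)
    -- the least squares estimate
    (w : Ω → EuclideanSpace ℝ (Fin d))
    (hw : ∀ ω, w ω = InvariantRegression.leastSquares (fun i => Xs i ω) (fun i => Ys i ω))
    -- the least squares predictor and its averaged version
    (h hbar : Ω → EuclideanSpace ℝ (Fin d) → ℝ)
    (hh : ∀ ω, h ω = InvariantRegression.linPredictor (w ω))
    (hhbar : ∀ ω, hbar ω = InvariantRegression.orbitAverage ν φ (h ω))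
    -- the dimension of `A`
    (D : ℕ)
    (hD : D = Module.finrank ℝ (InvariantRegression.antisymmetricSubspace
      (InvariantRegression.gaussianInput d σX) φ)) :
    -- the gap to the averaged version
    (d + 1 < n →
      Integrable (fun ω => InvariantRegression.genGap P X Y (h ω) (hbar ω)) P ∧
      ∫ ω, InvariantRegression.genGap P X Y (h ω) (hbar ω) ∂P
        = σξ ^ 2 * ((D : ℝ) / ((n : ℝ) - d - 1))) ∧
    (d ≤ n + 1 → n ≤ d + 1 → 0 < σξ →
      ¬ (∀ᵐ ω ∂P, InvariantRegression.IsInvariantPredictor φ (h ω)) →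
      (∀ᵐ ω ∂P, 0 ≤ InvariantRegression.genGap P X Y (h ω) (hbar ω)) ∧
      ∫⁻ ω, ENNReal.ofReal (InvariantRegression.genGap P X Y (h ω) (hbar ω)) ∂P = ⊤) ∧
    (n + 1 < d →
      Integrable (fun ω => InvariantRegression.genGap P X Y (h ω) (hbar ω)) P ∧
      ∫ ω, InvariantRegression.genGap P X Y (h ω) (hbar ω) ∂P
        = (D : ℝ) * (σX ^ 2 * ‖θ‖ ^ 2 * ((n * ((d : ℝ) - n)) / (d * ((d : ℝ) - 1) * (d + 2)))
          + σξ ^ 2 * (n / (d * ((d : ℝ) - n - 1))))) ∧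
    -- the gap to any other predictor with at most the risk of the averaged version
    (∀ h' : Ω → EuclideanSpace ℝ (Fin d) → ℝ,
      (∀ᵐ ω ∂P, MemLp (h' ω) 2 (InvariantRegression.gaussianInput d σX)) →
      AEMeasurable (fun ω => InvariantRegression.risk P X Y (h' ω)) P →
      (∀ᵐ ω ∂P, InvariantRegression.risk P X Y (h' ω) ≤ InvariantRegression.risk P X Y (hbar ω)) →
      (d + 1 < n →
        Integrable (fun ω => InvariantRegression.genGap P X Y (h ω) (h' ω)) P ∧
        ∫ ω, InvariantRegression.genGap P X Y (h ω) (h' ω) ∂P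
          ≥ σξ ^ 2 * ((D : ℝ) / ((n : ℝ) - d - 1))) ∧
      (d ≤ n + 1 → n ≤ d + 1 → 0 < σξ →
        ¬ (∀ᵐ ω ∂P, InvariantRegression.IsInvariantPredictor φ (h ω)) →
        (∀ᵐ ω ∂P, 0 ≤ InvariantRegression.genGap P X Y (h ω) (h' ω)) ∧
        ∫⁻ ω, ENNReal.ofReal (InvariantRegression.genGap P X Y (h ω) (h' ω)) ∂P = ⊤) ∧
      (n + 1 < d →
        Integrable (fun ω => InvariantRegression.genGap P X Y (h ω) (h' ω)) P ∧
        ∫ ω, InvariantRegression.genGap P X Y (h ω) (h' ω) ∂P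
          ≥ (D : ℝ) * (σX ^ 2 * ‖θ‖ ^ 2 * ((n * ((d : ℝ) - n)) / (d * ((d : ℝ) - 1) * (d + 2)))
            + σξ ^ 2 * (n / (d * ((d : ℝ) - n - 1)))))) := by
  have hθS : θ ∈ InvariantRegression.symmetricSubspace φ := hθ
  set A := (InvariantRegression.symmetricSubspace φ)ᗮ with hA
  have hθA : θ ∈ Aᗮ := by rwa [hA, Submodule.orthogonal_orthogonal]
  rw [InvariantRegression.antisymmetricSubspace_eq_orthogonal hσX, ← hA] at hD
  -- the law of the noise
  set lam := P.map ξ with hlam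
  have hξm : AEMeasurable ξ P := hξ.aemeasurable
  have : IsProbabilityMeasure lam := Measure.isProbabilityMeasure_map hξm
  have hlam2 : MemLp id 2 lam :=
    (memLp_map_measure_iff aestronglyMeasurable_id hξm).2 hξ
  have hlam_mean : ∫ r, r ∂lam = 0 := by
    rw [hlam, integral_map hξm (by fun_prop), hξ_mean]
  have hlam_var : ∫ r, r ^ 2 ∂lam = σξ ^ 2 := by
    rw [hlam, integral_map hξm (by fun_prop), ← hξ_var, variance_of_integral_eq_zero hξm hξ_mean]
  -- the estimate in terms of the inputs and the noise
  have hsample := InvariantRegression.map_sample_eq_prod hX hξm hXξ hY h_law h_indep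
  have hwp : ∀ ω, w ω = InvariantRegression.noisyEstimate θ
      ((fun i => Xs i ω), fun i => Ys i ω - InvariantRegression.linPredictor θ (Xs i ω)) :=
    fun ω => by
      rw [hw, InvariantRegression.noisyEstimate,
        ← InvariantRegression.leastSquares_linPredictor_add]
      simp
  have hwm : AEMeasurable w P := by
    rw [funext hwp]
    exact (InvariantRegression.measurable_noisyEstimate θ).comp_aemeasurable hsample.aemeasurable
  -- expectations over the sample are integrals over independent inputs and noise
  have htransfer : ∀ F : EuclideanSpace ℝ (Fin d) → ENNReal, Measurable F →
      ∫⁻ ω, F (w ω) ∂P = ∫⁻ p, F (InvariantRegression.noisyEstimate θ p)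
        ∂((InvariantRegression.sampleLaw d n σX).prod (Measure.pi fun _ : Fin n => lam)) :=
    fun F hF => by
      simp only [hwp]
      exact hsample.lintegral_comp (f := fun p => F (InvariantRegression.noisyEstimate θ p))
        (hF.comp (InvariantRegression.measurable_noisyEstimate θ)).aemeasurable
  -- the gap and the risk as functions of the estimate
  have hgap : ∀ ω, InvariantRegression.genGap P X Y (h ω) (hbar ω)
      = σX ^ 2 * ‖A.starProjection (w ω)‖ ^ 2 := fun ω => by
    rw [hhbar, hh]
    exact InvariantRegression.genGap_linPredictor_orbitAverage ν φ hφ hθS hX hξ hξ_mean hξ_var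
      hXξ hY (w ω)
  have hgap0 : ∀ ω, 0 ≤ InvariantRegression.genGap P X Y (h ω) (hbar ω) := fun ω => by
    rw [hgap]
    positivity
  have hgapm : AEMeasurable (fun ω => InvariantRegression.genGap P X Y (h ω) (hbar ω)) P := by
    simp only [hgap]
    fun_prop
  have hgapl : ∫⁻ ω, ENNReal.ofReal (InvariantRegression.genGap P X Y (h ω) (hbar ω)) ∂P
      = ENNReal.ofReal (σX ^ 2) * ∫⁻ p,
        ENNReal.ofReal (‖A.starProjection (InvariantRegression.noisyEstimate θ p)‖ ^ 2)
        ∂((InvariantRegression.sampleLaw d n σX).prod (Measure.pi fun _ : Fin n => lam)) := by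
    simp only [hgap, ENNReal.ofReal_mul (sq_nonneg σX)]
    rw [lintegral_const_mul'' _ (by fun_prop),
      htransfer (fun v => ENNReal.ofReal (‖A.starProjection v‖ ^ 2)) (by fun_prop)]
  -- needed to compare with other predictors, whose risk is only bounded above
  have hrisk : d + 1 < n ∨ n + 1 < d →
      Integrable (fun ω => InvariantRegression.risk P X Y (h ω)) P := fun hdn => by
    have hw2 : MemLp w 2 P := by
      rw [memLp_two_iff_integrable_sq_norm hwm.aestronglyMeasurable]
      refine ⟨(hwm.norm.pow_const 2).aestronglyMeasurable, ?_⟩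
      rw [hasFiniteIntegral_iff_ofReal (ae_of_all _ fun ω => sq_nonneg _),
        htransfer (fun v => ENNReal.ofReal (‖v‖ ^ 2)) (by fun_prop)]
      exact (InvariantRegression.lintegral_norm_sq_noisyEstimate_ne_top hσX hdn θ hlam2 hlam_mean
        hlam_var).lt_top
    have hsub : Integrable (fun ω => ‖w ω - θ‖ ^ 2) P :=
      (hw2.sub (memLp_const θ)).norm.integrable_sq
    simp only [hh, InvariantRegression.risk_linPredictor hX hξ hξ_mean hξ_var hXξ hY]
    exact (hsub.const_mul _).add (integrable_const _)
  have hpart1 : d + 1 < n →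
      Integrable (fun ω => InvariantRegression.genGap P X Y (h ω) (hbar ω)) P ∧
      ∫ ω, InvariantRegression.genGap P X Y (h ω) (hbar ω) ∂P
        = σξ ^ 2 * ((D : ℝ) / ((n : ℝ) - d - 1)) := fun hn => by
    have hn' : (0 : ℝ) < (n : ℝ) - d - 1 := by
      have : (d : ℝ) + 1 < n := by exact_mod_cast hn
      linarith
    refine InvariantRegression.integrable_and_integral_eq_of_lintegral_ofReal hgapm hgap0
      (by positivity) ?_
    rw [hgapl, InvariantRegression.lintegral_estimate_of_gt hσX hn hlam2 hlam_mean hlam_var A hθA,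
      ← ENNReal.ofReal_mul (sq_nonneg σX), ← hD]
    congr 1
    field_simp
  have hpart2 : d ≤ n + 1 → n ≤ d + 1 → 0 < σξ →
      ¬ (∀ᵐ ω ∂P, InvariantRegression.IsInvariantPredictor φ (h ω)) →
      (∀ᵐ ω ∂P, 0 ≤ InvariantRegression.genGap P X Y (h ω) (hbar ω)) ∧
      ∫⁻ ω, ENNReal.ofReal (InvariantRegression.genGap P X Y (h ω) (hbar ω)) ∂P = ⊤ := by
    intro h1 h2 hpos hninv
    have hne : ¬ (n = 0 ∨ Module.finrank ℝ A = 0) := fun h0 => hninv (ae_of_all _ fun ω => by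
      rw [hh, hw]
      exact InvariantRegression.isInvariantPredictor_leastSquares φ _ _ h0)
    rw [not_or] at hne
    refine ⟨ae_of_all _ hgap0, ?_⟩
    rw [hgapl, InvariantRegression.lintegral_estimate_eq_top hσX hne.1 h1 h2 θ hpos hlam2
      hlam_mean hlam_var A hne.2, ENNReal.mul_top]
    simpa using hσX.ne'
  have hpart3 : n + 1 < d →
      Integrable (fun ω => InvariantRegression.genGap P X Y (h ω) (hbar ω)) P ∧
      ∫ ω, InvariantRegression.genGap P X Y (h ω) (hbar ω) ∂P
        = (D : ℝ) * (σX ^ 2 * ‖θ‖ ^ 2 * ((n * ((d : ℝ) - n)) / (d * ((d : ℝ) - 1) * (d + 2)))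
          + σξ ^ 2 * (n / (d * ((d : ℝ) - n - 1)))) := fun hn => by
    have hn' : (n : ℝ) + 1 < d := by exact_mod_cast hn
    have hn0 : (0 : ℝ) ≤ n := Nat.cast_nonneg n
    have hd1 : (0 : ℝ) < (d : ℝ) - 1 := by linarith
    have hd0 : (0 : ℝ) < (d : ℝ) := by linarith
    have hdn : (0 : ℝ) < (d : ℝ) - n := by linarith
    have hdn1 : (0 : ℝ) < (d : ℝ) - n - 1 := by linarith
    refine InvariantRegression.integrable_and_integral_eq_of_lintegral_ofReal hgapm hgap0
      (by positivity) ?_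
    rw [hgapl, InvariantRegression.lintegral_estimate_of_lt hσX hn hlam2 hlam_mean hlam_var A hθA,
      ← ENNReal.ofReal_mul (sq_nonneg σX), ← hD]
    congr 1
    field_simp
  refine ⟨hpart1, hpart2, hpart3, fun h' _ hm' hle => ⟨fun hn => ?_, ?_, fun hn => ?_⟩⟩
  · have hcmp := InvariantRegression.integrable_sub_and_integral_le (hrisk (Or.inl hn))
      (hpart1 hn).1 hm' (fun ω => InvariantRegression.risk_nonneg P X Y (h' ω)) hle
    exact ⟨hcmp.1, hcmp.2.trans_eq' (hpart1 hn).2⟩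
  · intro h1 h2 hpos hninv
    have hcmp : ∀ᵐ ω ∂P, InvariantRegression.genGap P X Y (h ω) (hbar ω)
        ≤ InvariantRegression.genGap P X Y (h ω) (h' ω) := by
      filter_upwards [hle] with ω hω
      unfold InvariantRegression.genGap
      linarith
    refine ⟨by filter_upwards [hcmp] with ω hω using (hgap0 ω).trans hω, ?_⟩
    rw [eq_top_iff, ← (hpart2 h1 h2 hpos hninv).2]
    refine lintegral_mono_ae ?_
    filter_upwards [hcmp] with ω hω using ENNReal.ofReal_le_ofReal hω
  · have hcmp := InvariantRegression.integrable_sub_and_integral_le (hrisk (Or.inr hn))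
      (hpart3 hn).1 hm' (fun ω => InvariantRegression.risk_nonneg P X Y (h' ω)) hle
    exact ⟨hcmp.1, hcmp.2.trans_eq' (hpart3 hn).2⟩
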